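/- **Setting.** Let $V:\mathbb R\to\mathbb R$ be lower semicontinuous with $\frac{V(x)}2-\log|x|\to+\infty$ as $|x|\to\infty$, and let $$\mathcal F(\mu)=\iint_{\mathbb R\times\mathbb R}-\log|x-y|\,d\mu(x)\,d\mu(y)+\int_{\mathbb R}V\,d\mu$$ for probability measures $\mu$ on $\mathbb R$ (with $\mathcal F(\mu)=+\infty$ if $\int V\,d\mu=+\infty$). Let $\mu_0$ be the minimizer of $\mathcal F$ among probability measures (the equilibrium measure) and $\Sigma$ its support. Assume that: - $\mu_0$ has a density $m_0\in C^{0,1/2}(\mathbb R)$ with respect to Lebesgue measure; - $\Sigma$ is a finite union of compact intervals; - there are $\gamma,\overline m>0$ with $\gamma\sqrt{\mathrm{dist}(x,\mathbb R\setminus\Sigma)}\le m_0(x)\le\overline m$ for all $x\in\mathbb R$; - $\int_{\mathbb R\setminus[-1,1]}e^{-\beta_1(V(x)/2-\log|x|)}\,dx<+\infty$ for some $\beta_1>0$. Let $U^{\mu_0}(x)=-\int\log|x-y|\,d\mu_0(y)$. "Quasi-everywhere" means outside a set of zero (inner) logarithmic capacity. For $n\ge1$ and $x_1,\dots,x_n\in\mathbb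 R$ let $$w_n(x_1,\dots,x_n)=-\sum_{i\ne j}\log|x_i-x_j|+n\sum_{i=1}^nV(x_i)\in(-\infty,+\infty]$$ (the first sum is over ordered pairs, and $-\log 0=+\infty$), put $x_i'=nx_i$, and define on $\mathbb R^2$, where $\mathbb R$ is identified with $\mathbb R\times\{0\}$, $$H_n'=-2\pi\Delta^{-1}\Big(\sum_{i=1}^n\delta_{x_i'}-m_0(\cdot/n)\,\delta_{\mathbb R}\Big),$$ where $\Delta^{-1}$ is convolution with $\frac1{2\pi}\log|\cdot|$ in $\mathbb R^2$ and $\delta_{\mathbb R}$ is the length measure on $\mathbb R\times\{0\}$. For the set $\Lambda=\{x_1',\dots,x_n'\}$ of charges let $$W(\nabla H_n',\mathbf 1_{\mathbb R^2})=\lim_{\eta\to0^+}\Big(\frac12\int_{\mathbb R^2\setminus\bigcup_{p\in\Lambda}B(p,\eta)}|\nabla H_n'|^2+\pi\log\eta\;\#\Lambda\Big).$$ **Lemma (splitting formula).** There is a unique constant $c\in\mathbb R$ such that $U^{\mu_0}+\frac V2=c$ quasi-everywhere in $\Sigma$ and $U^{\mu_0}+\frac V2\ge c$ quasi-everywhere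 in $\mathbb R$. With this $c$ and $\zeta=U^{\mu_0}+\frac V2-c$, for every $n\ge1$ and all $x_1,\dots,x_n\in\mathbb R$ the limit defining $W(\nabla H_n',\mathbf 1_{\mathbb R^2})$ exists in $[-\infty,+\infty]$ and $$w_n(x_1,\dots,x_n)=n^2\mathcal F(\mu_0)-n\log n+\frac1\pi W(\nabla H_n',\mathbf 1_{\mathbb R^2})+2n\sum_{i=1}^n\zeta(x_i)$$ as an identity in $[-\infty,+\infty]$ (both sides being $+\infty$ when two of the points coincide). -/

import Mathlib

open MeasureTheory Filter Topology

noncomputable section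

namespace LogGas

/-- The integral of an extended-real function, `∫ f⁺ - ∫ f⁻`, with values in `[-∞, +∞]`.  It is the
usual integral as soon as one of the two parts is finite. -/
def eintegral {α : Type*} [MeasurableSpace α] (μ : Measure α) (f : α → EReal) : EReal :=
  ((∫⁻ a, (f a).toENNReal ∂μ : ENNReal) : EReal) - ((∫⁻ a, (-f a).toENNReal ∂μ : ENNReal) : EReal)

/-- The logarithmic kernel `-log |x - y|`, equal to `+∞` when `x = y`. -/
def logKernel (x y : ℝ) : EReal :=
  -ENNReal.log (edist x y)

/-- The Hamiltonian
`w_n (x_1, …, x_n) = - ∑_{i ≠ j} log |x_i - x_j| + n ∑_i V (x_i)` (a sum over ordered pairs),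
equal to `+∞` when two of the points coincide. -/
def hamiltonian (V : ℝ → ℝ) (n : ℕ) (x : Fin n → ℝ) : EReal :=
  (∑ i, ∑ j ∈ Finset.univ.erase i, logKernel (x i) (x j)) + ((n * ∑ i, V (x i) : ℝ) : EReal)

/-- The logarithmic energy `∬ - log |x - y| dμ(x) dμ(y)`. -/
def logEnergy (μ : Measure ℝ) : EReal :=
  eintegral (μ.prod μ) (fun p => logKernel p.1 p.2)

open Classical in
/-- The mean-field energy `F(μ) = ∬ - log |x - y| dμ(x) dμ(y) + ∫ V dμ`, with the convention
`F(μ) = +∞` if `∫ V dμ = +∞`.  (If `V / 2 - log |x| → +∞` at infinity, `V` is bounded below and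
`∫ V dμ < +∞`, then the double integral is well defined in `(-∞, +∞]`.) -/
def meanFieldEnergy (V : ℝ → ℝ) (μ : Measure ℝ) : EReal :=
  if ∫⁻ x, ENNReal.ofReal (V x) ∂μ = ⊤ then ⊤
  else logEnergy μ + eintegral μ (fun x => (V x : EReal))

/-- `μ₀` minimizes the mean-field energy among the probability measures on `ℝ`. -/
def IsEquilibriumMeasure (V : ℝ → ℝ) (μ₀ : Measure ℝ) : Prop :=
  IsProbabilityMeasure μ₀ ∧
    ∀ μ : Measure ℝ, IsProbabilityMeasure μ → meanFieldEnergy V μ₀ ≤ meanFieldEnergy V μ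

/-- A set of zero (inner) logarithmic capacity: it carries no compactly supported probability
measure of finite logarithmic energy. -/
def HasZeroCapacity (A : Set ℝ) : Prop :=
  ∀ μ : Measure ℝ, IsProbabilityMeasure μ → ∀ K : Set ℝ, IsCompact K → K ⊆ A → μ Kᶜ = 0 →
    logEnergy μ = ⊤

/-- The property `P` holds quasi-everywhere in the set `A`. -/
def QuasiEverywhereIn (A : Set ℝ) (P : ℝ → Prop) : Prop :=
  HasZeroCapacity {x | x ∈ A ∧ ¬ P x}

/-- The logarithmic potential `U^μ (x) = - ∫ log |x - y| dμ(y)`. -/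
def logPotential (μ : Measure ℝ) (x : ℝ) : ℝ :=
  -∫ y, Real.log |x - y| ∂μ

/-- `c` is the constant of the Euler–Lagrange conditions for `μ`: `U^μ + V / 2 = c`
quasi-everywhere in the support of `μ`, and `U^μ + V / 2 ≥ c` quasi-everywhere. -/
def IsEquilibriumConstant (V : ℝ → ℝ) (μ : Measure ℝ) (c : ℝ) : Prop :=
  QuasiEverywhereIn μ.support (fun x => logPotential μ x + V x / 2 = c) ∧
    QuasiEverywhereIn Set.univ (fun x => c ≤ logPotential μ x + V x / 2)

/-- `ζ = U^μ + V / 2 - c`. -/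
def zeta (V : ℝ → ℝ) (μ : Measure ℝ) (c : ℝ) (x : ℝ) : ℝ :=
  logPotential μ x + V x / 2 - c

/-- The plane, with its Euclidean norm and Lebesgue measure. -/
abbrev Plane : Type := EuclideanSpace ℝ (Fin 2)

/-- The embedding `x ↦ (x, 0)` of the real line in the plane. -/
def onLine (x : ℝ) : Plane := !₂[x, 0]

/-- The operator `Δ⁻¹` on positive measures of the plane: convolution with
`(1 / 2π) log |·|`. -/
def invLaplacian (μ : Measure Plane) (z : Plane) : ℝ :=
  1 / (2 * Real.pi) * ∫ y, Real.log ‖z - y‖ ∂μ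

/-- The measure `m δ_ℝ` on the plane: `∫ φ d(m δ_ℝ) = ∫ φ(x, 0) m(x) dx`, for a nonnegative
density `m` on the line. -/
def lineMeasure (m : ℝ → ℝ) : Measure Plane :=
  (volume.withDensity (fun t => ENNReal.ofReal (m t))).map onLine

/-- The blown-up potential
`H_n' = - 2π Δ⁻¹ (∑_i δ_{x_i'} - m₀(x' / n) δ_ℝ)` with `x_i' = n x_i`. -/
def blownUpPotential (m₀ : ℝ → ℝ) (n : ℕ) (x : Fin n → ℝ) (z : Plane) : ℝ :=
  -(2 * Real.pi) * (invLaplacian (∑ i, Measure.dirac (onLine (n * x i))) z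
    - invLaplacian (lineMeasure (fun t => m₀ (t / n))) z)

/-- `½ ∫_{ℝ² ∖ ⋃_{p ∈ Λ} B(p, η)} χ̄ |E|² + π log η ∑_{p ∈ Λ} χ(p)`, where
`χ̄ (x, y) = χ(x)`, for a finite set `Λ` of points of the real line. -/
def truncatedEnergy (E : Plane → Plane) (Λ : Finset ℝ) (χ : ℝ → ℝ) (η : ℝ) : EReal :=
  ((1 / 2 : ℝ) : EReal) *
      eintegral (volume.restrict (⋃ p ∈ Λ, Metric.ball (onLine p) η)ᶜ)
        (fun z => ((χ (z 0) * ‖E z‖ ^ 2 : ℝ) : EReal))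
    + ((Real.pi * Real.log η * ∑ p ∈ Λ, χ p : ℝ) : EReal)

/-- `W(E, χ)` exists in `[-∞, +∞]` and equals `w`: it is the limit of the truncated energies as
`η → 0⁺`, where `Λ` is the set of point charges of `E`. -/
def HasRenormalizedEnergy (E : Plane → Plane) (Λ : Finset ℝ) (χ : ℝ → ℝ) (w : EReal) : Prop :=
  Tendsto (truncatedEnergy E Λ χ) (𝓝[>] 0) (𝓝 w)

end LogGas

end

/-!
Integrating the Euler–Lagrange equality `U^{μ₀} + V / 2 = c` against `μ₀` identifies `c`; it holds
because `μ₀` minimizes a quadratic functional and `U^{μ₀}` is continuous.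

The gradient of the blown-up potential is the Cauchy transform of the difference `ν` between the
charges and the background. Away from the strip `|Im z| ≤ δ`, the squared Cauchy transform of
a measure on the line expands into pairs `1 / ((z - s) (conj z - t))`, whose integral is explicit,
so that its total energy is a smeared logarithmic energy of `ν`. Removing discs around the charges
instead of a strip changes the result by the energy of single charges, which is computed explicitly
and accounts for the term `π log η`. As `δ → 0` this yields
`W = π (∬_{x ≠ y} -log |x - y| dν dν)`, whose linear term in the charges is a sum of values of
`U^{μ₀}`, eliminated by means of `ζ`; the dilation by `n` produces `n log n`. When points coincide,
a charge `k ≥ 2` contributes `-π k² log η` to the energy but only `π log η` is added back, and both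
sides are `+∞`.
-/

namespace LogGas

/-! ### Logarithmic energies -/

lemma eintegral_eq_coe {α : Type*} [MeasurableSpace α] {μ : Measure α} {f : α → EReal} {g : α → ℝ}
    (hg : Integrable g μ) (h : f =ᵐ[μ] fun a => (g a : EReal)) :
    eintegral μ f = ((∫ a, g a ∂μ : ℝ) : EReal) := by
  have hpos : ∫⁻ a, (f a).toENNReal ∂μ = ∫⁻ a, ENNReal.ofReal (g a) ∂μ := by
    refine lintegral_congr_ae ?_
    filter_upwards [h] with a ha
    rw [ha, EReal.real_coe_toENNReal]
  have hneg : ∫⁻ a, (-f a).toENNReal ∂μ = ∫⁻ a, ENNReal.ofReal (-g a) ∂μ := by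
    refine lintegral_congr_ae ?_
    filter_upwards [h] with a ha
    rw [ha, ← EReal.coe_neg, EReal.real_coe_toENNReal]
  have hfin : ∫⁻ a, ENNReal.ofReal (-g a) ∂μ ≠ ⊤ := hg.neg.lintegral_lt_top.ne
  rw [eintegral, hpos, hneg, integral_eq_lintegral_pos_part_sub_lintegral_neg_part hg,
    EReal.coe_sub, EReal.coe_ennreal_toReal hg.lintegral_lt_top.ne,
    EReal.coe_ennreal_toReal hfin]

lemma lintegral_toENNReal_ne_top_of_eintegral_ne_top {α : Type*} [MeasurableSpace α]
    {μ : Measure α} {f : α → EReal} (h : eintegral μ f ≠ ⊤)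
    (hneg : ∫⁻ a, (-f a).toENNReal ∂μ ≠ ⊤) : ∫⁻ a, (f a).toENNReal ∂μ ≠ ⊤ := by
  intro htop
  apply h
  rw [eintegral, htop, EReal.coe_ennreal_top, sub_eq_add_neg]
  apply EReal.top_add_of_ne_bot
  rw [Ne, EReal.neg_eq_bot_iff]
  simpa using hneg

lemma enorm_le_toENNReal_add_toENNReal_neg (r : ℝ) :
    ‖r‖ₑ ≤ (r : EReal).toENNReal + (-(r : EReal)).toENNReal := by
  rw [← EReal.coe_neg, EReal.real_coe_toENNReal, EReal.real_coe_toENNReal, ← ofReal_norm,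
    Real.norm_eq_abs]
  rcases le_total 0 r with hr | hr
  · rw [abs_of_nonneg hr]
    exact le_self_add
  · rw [abs_of_nonpos hr]
    exact le_add_self

lemma logKernel_self (x : ℝ) : logKernel x x = ⊤ := by
  simp [logKernel]

lemma logKernel_of_ne {x y : ℝ} (h : x ≠ y) :
    logKernel x y = ((-Real.log |x - y| : ℝ) : EReal) := by
  have : 0 < |x - y| := abs_pos.2 (sub_ne_zero.2 h)
  rw [logKernel, edist_dist, Real.dist_eq, ENNReal.log_ofReal_of_pos this, EReal.coe_neg]

lemma logKernel_ne_bot (x y : ℝ) : logKernel x y ≠ ⊥ := by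
  rcases eq_or_ne x y with rfl | h
  · simp [logKernel_self]
  · rw [logKernel_of_ne h]
    exact EReal.coe_ne_bot _

lemma measurable_log_abs_sub : Measurable fun p : ℝ × ℝ => Real.log |p.1 - p.2| :=
  Real.measurable_log.comp (measurable_fst.sub measurable_snd).abs

lemma measurable_logKernel : Measurable fun p : ℝ × ℝ => logKernel p.1 p.2 :=
  (ENNReal.measurable_log.comp (measurable_fst.edist measurable_snd)).neg

/-- The mutual logarithmic energy `∬ - log |x - y| dμ(x) dν(y)` as a real number; it is meaningful
under `HasMutualEnergy μ ν`. -/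
noncomputable def mutualEnergy (μ ν : Measure ℝ) : ℝ :=
  ∫ p, -Real.log |p.1 - p.2| ∂μ.prod ν

/-- The mutual logarithmic energy of `μ` and `ν` is an absolutely convergent integral.  As
`Real.log 0 = 0`, integrability does not see the diagonal, which has to be null. -/
structure HasMutualEnergy (μ ν : Measure ℝ) : Prop where
  integrable : Integrable (fun p : ℝ × ℝ => Real.log |p.1 - p.2|) (μ.prod ν)
  ae_ne : ∀ᵐ p ∂μ.prod ν, p.1 ≠ p.2

section

variable {μ ν : Measure ℝ} [SFinite μ] [SFinite ν]

lemma HasMutualEnergy.symm (h : HasMutualEnergy μ ν) : HasMutualEnergy ν μ := by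
  refine ⟨?_, ?_⟩
  · refine h.integrable.swap.congr (ae_of_all _ fun p => ?_)
    simp only [Function.comp, Prod.fst_swap, Prod.snd_swap, abs_sub_comm]
  · have := (Measure.measurePreserving_swap (μ := ν) (ν := μ)).quasiMeasurePreserving.ae h.ae_ne
    filter_upwards [this] with p hp heq
    exact hp heq.symm

lemma mutualEnergy_comm (μ ν : Measure ℝ) [SFinite μ] [SFinite ν] :
    mutualEnergy μ ν = mutualEnergy ν μ := by
  rw [mutualEnergy, ← integral_prod_swap]
  simp [mutualEnergy, abs_sub_comm]

lemma mutualEnergy_eq_integral_logPotential (h : HasMutualEnergy ν μ) :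
    mutualEnergy ν μ = ∫ x, logPotential μ x ∂ν := by
  simp only [mutualEnergy, logPotential, integral_neg]
  rw [integral_prod _ h.integrable]

end

lemma HasMutualEnergy.integrable_logPotential {μ ν : Measure ℝ} [SFinite μ]
    (h : HasMutualEnergy ν μ) : Integrable (logPotential μ) ν :=
  h.integrable.integral_prod_left.neg

lemma logEnergy_eq_mutualEnergy {μ : Measure ℝ} (h : HasMutualEnergy μ μ) :
    logEnergy μ = mutualEnergy μ μ := by
  refine eintegral_eq_coe h.integrable.neg ?_
  filter_upwards [h.ae_ne] with p hp
  exact logKernel_of_ne hp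

lemma meanFieldEnergy_eq_coe {V : ℝ → ℝ} {μ : Measure ℝ} (h : HasMutualEnergy μ μ)
    (hV : Integrable V μ) :
    meanFieldEnergy V μ = ((mutualEnergy μ μ + ∫ x, V x ∂μ : ℝ) : EReal) := by
  rw [meanFieldEnergy, if_neg hV.lintegral_lt_top.ne, logEnergy_eq_mutualEnergy h,
    eintegral_eq_coe hV (ae_eq_refl _), ← EReal.coe_add]

lemma ae_prod_abs_sub_le {μ ν : Measure ℝ} [SFinite μ] [SFinite ν] {L L' : ℝ}
    (hμ : ∀ᵐ t ∂μ, |t| ≤ L) (hν : ∀ᵐ t ∂ν, |t| ≤ L') :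
    ∀ᵐ p ∂μ.prod ν, |p.1 - p.2| ≤ L + L' := by
  filter_upwards [Measure.quasiMeasurePreserving_fst.ae hμ,
    Measure.quasiMeasurePreserving_snd.ae hν] with p hp hp'
  exact (abs_sub _ _).trans (add_le_add hp hp')

lemma exists_ae_abs_le_of_isCompact {μ : Measure ℝ} {K : Set ℝ} (hK : IsCompact K)
    (hμK : ∀ᵐ t ∂μ, t ∈ K) : ∃ L, ∀ᵐ t ∂μ, |t| ≤ L := by
  obtain ⟨L, hL⟩ := hK.isBounded.subset_closedBall 0
  exact ⟨L, hμK.mono fun t ht => by simpa using hL ht⟩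

lemma lintegral_neg_logKernel_ne_top {μ ν : Measure ℝ} [IsFiniteMeasure μ] [IsFiniteMeasure ν]
    {L L' : ℝ} (hμ : ∀ᵐ t ∂μ, |t| ≤ L) (hν : ∀ᵐ t ∂ν, |t| ≤ L') :
    ∫⁻ p, (-logKernel p.1 p.2).toENNReal ∂μ.prod ν ≠ ⊤ := by
  have hle : ∀ᵐ p ∂μ.prod ν, (-logKernel p.1 p.2).toENNReal ≤ ENNReal.ofReal (L + L') := by
    filter_upwards [ae_prod_abs_sub_le hμ hν] with p hp
    rcases eq_or_ne p.1 p.2 with heq | hne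
    · simp [heq, logKernel_self]
    · rw [logKernel_of_ne hne, ← EReal.coe_neg, EReal.real_coe_toENNReal, neg_neg]
      exact ENNReal.ofReal_le_ofReal ((Real.log_le_self (abs_nonneg _)).trans hp)
  refine ne_top_of_le_ne_top ?_ (lintegral_mono_ae hle)
  rw [lintegral_const]
  exact ENNReal.mul_ne_top ENNReal.ofReal_ne_top (measure_ne_top _ _)

lemma hasMutualEnergy_of_logEnergy_ne_top {μ : Measure ℝ} [IsFiniteMeasure μ] {L : ℝ}
    (hL : ∀ᵐ t ∂μ, |t| ≤ L) (h : logEnergy μ ≠ ⊤) : HasMutualEnergy μ μ := by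
  have hneg := lintegral_neg_logKernel_ne_top hL hL
  have hpos := lintegral_toENNReal_ne_top_of_eintegral_ne_top h hneg
  have hmeas : Measurable fun p : ℝ × ℝ => (logKernel p.1 p.2).toENNReal :=
    measurable_logKernel.ereal_toENNReal
  have hne : ∀ᵐ p ∂μ.prod μ, p.1 ≠ p.2 := by
    filter_upwards [ae_lt_top hmeas hpos] with p hp heq
    simp [heq, logKernel_self] at hp
  refine ⟨⟨measurable_log_abs_sub.aestronglyMeasurable, ?_⟩, hne⟩
  calc ∫⁻ p, ‖Real.log |p.1 - p.2|‖ₑ ∂μ.prod μ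
      ≤ ∫⁻ p, (logKernel p.1 p.2).toENNReal + (-logKernel p.1 p.2).toENNReal ∂μ.prod μ := by
        refine lintegral_mono_ae ?_
        filter_upwards [hne] with p hp
        rw [← enorm_neg, logKernel_of_ne hp]
        exact enorm_le_toENNReal_add_toENNReal_neg _
    _ < ⊤ := by
        rw [lintegral_add_left hmeas]
        exact ENNReal.add_lt_top.2 ⟨hpos.lt_top, hneg.lt_top⟩

lemma smul_add_smul_prod_self {α : Type*} [MeasurableSpace α] (μ ν : Measure α) [SFinite μ]
    [SFinite ν] (a b : ENNReal) :
    (a • μ + b • ν).prod (a • μ + b • ν) =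
      (a * a) • μ.prod μ + (a * b) • μ.prod ν + ((b * a) • ν.prod μ + (b * b) • ν.prod ν) := by
  rw [Measure.prod_add, Measure.add_prod, Measure.add_prod]
  simp only [Measure.prod_smul_left, Measure.prod_smul_right, smul_smul]
  rw [mul_comm b a]
  abel

section

variable {μ ν : Measure ℝ} [SFinite μ] [SFinite ν] (hμ : HasMutualEnergy μ μ)
  (hμν : HasMutualEnergy μ ν) (hν : HasMutualEnergy ν ν) {a b : ENNReal} (ha : a ≠ ⊤) (hb : b ≠ ⊤)

include hμ hμν hν ha hb

lemma HasMutualEnergy.smul_add_smul : HasMutualEnergy (a • μ + b • ν) (a • μ + b • ν) where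
  integrable := by
    rw [smul_add_smul_prod_self]
    exact ((hμ.integrable.smul_measure (ENNReal.mul_ne_top ha ha)).add_measure
      (hμν.integrable.smul_measure (ENNReal.mul_ne_top ha hb))).add_measure
        ((hμν.symm.integrable.smul_measure (ENNReal.mul_ne_top hb ha)).add_measure
          (hν.integrable.smul_measure (ENNReal.mul_ne_top hb hb)))
  ae_ne := by
    rw [smul_add_smul_prod_self]
    simp only [ae_add_measure_iff]
    exact ⟨⟨Measure.ae_smul_measure hμ.ae_ne _, Measure.ae_smul_measure hμν.ae_ne _⟩,
      Measure.ae_smul_measure hμν.symm.ae_ne _, Measure.ae_smul_measure hν.ae_ne _⟩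

lemma mutualEnergy_smul_add_smul :
    mutualEnergy (a • μ + b • ν) (a • μ + b • ν) =
      a.toReal ^ 2 * mutualEnergy μ μ + 2 * a.toReal * b.toReal * mutualEnergy ν μ
        + b.toReal ^ 2 * mutualEnergy ν ν := by
  have hint_μμ := hμ.integrable.neg.smul_measure (ENNReal.mul_ne_top ha ha)
  have hint_μν := hμν.integrable.neg.smul_measure (ENNReal.mul_ne_top ha hb)
  have hint_νμ := hμν.symm.integrable.neg.smul_measure (ENNReal.mul_ne_top hb ha)
  have hint_νν := hν.integrable.neg.smul_measure (ENNReal.mul_ne_top hb hb)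
  have hsum := (integral_add_measure (hint_μμ.add_measure hint_μν)
    (hint_νμ.add_measure hint_νν)).trans (congrArg₂ (· + ·)
      (integral_add_measure hint_μμ hint_μν) (integral_add_measure hint_νμ hint_νν))
  simp only [integral_smul_measure, ENNReal.toReal_mul, smul_eq_mul, Pi.neg_apply] at hsum
  rw [mutualEnergy, smul_add_smul_prod_self, hsum, ← mutualEnergy, ← mutualEnergy, ← mutualEnergy,
    ← mutualEnergy, mutualEnergy_comm μ ν]
  ring

end

/-! ### Measures with a bounded density -/

lemma integrableOn_abs_rpow {r : ℝ} (hr : -1 < r) (S : ℝ) :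
    IntegrableOn (fun x : ℝ => |x| ^ r) (Set.Icc (-S) S) := by
  rcases lt_or_ge S 0 with hS | hS
  · simp [Set.Icc_eq_empty (show ¬ -S ≤ S by linarith)]
  have hright : IntervalIntegrable (fun x : ℝ => |x| ^ r) volume 0 S := by
    refine (intervalIntegral.intervalIntegrable_rpow' hr).congr fun x hx => ?_
    rw [Set.uIoc_of_le hS] at hx
    rw [abs_of_pos hx.1]
  have hleft : IntervalIntegrable (fun x : ℝ => |x| ^ r) volume 0 (-S) := by
    simpa using (IntervalIntegrable.iff_comp_neg (by simp)).1 hright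
  rw [integrableOn_Icc_iff_integrableOn_Ioc,
    ← intervalIntegrable_iff_integrableOn_Ioc_of_le (by linarith)]
  exact hleft.symm.trans hright

lemma abs_log_le_rpow_add (u : ℝ) : |Real.log u| ≤ 2 * |u| ^ (-(1 / 2) : ℝ) + |u| := by
  rw [← Real.log_abs u]
  have hpow : 0 ≤ |u| ^ (-(1 / 2) : ℝ) := by positivity
  have hle : Real.log |u| ≤ |u| := Real.log_le_self (abs_nonneg u)
  have hneg : -Real.log |u| ≤ |u|⁻¹ ^ (1 / 2 : ℝ) / (1 / 2) := by
    rw [← Real.log_inv]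
    exact Real.log_le_rpow_div (by positivity) (by norm_num)
  rw [Real.inv_rpow (abs_nonneg u), ← Real.rpow_neg (abs_nonneg u)] at hneg
  exact abs_le.2 ⟨by linarith [abs_nonneg u], by linarith⟩

lemma log_sub_log_le_rpow {a b : ℝ} (ha : 0 < a) (hab : a ≤ b) :
    Real.log b - Real.log a ≤ 2 * |b - a| ^ (1 / 2 : ℝ) * a ^ (-(1 / 2) : ℝ) := by
  have hsub : (b / a) ^ (1 / 2 : ℝ) ≤ (b - a) ^ (1 / 2 : ℝ) * a ^ (-(1 / 2) : ℝ) + 1 := by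
    have := Real.rpow_add_le_add_rpow (p := 1 / 2) (div_nonneg (sub_nonneg.2 hab) ha.le)
      zero_le_one (by norm_num) (by norm_num)
    rwa [div_add_one ha.ne', sub_add_cancel, Real.one_rpow,
      Real.div_rpow (sub_nonneg.2 hab) ha.le, div_eq_mul_inv (_ ^ _), ← Real.rpow_neg ha.le] at this
  have hpos : 0 < b / a := div_pos (ha.trans_le hab) ha
  have hlog : 1 / 2 * Real.log (b / a) ≤ (b / a) ^ (1 / 2 : ℝ) - 1 := by
    rw [← Real.log_rpow hpos]
    exact Real.log_le_sub_one_of_pos (by positivity)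
  rw [← Real.log_div (ha.trans_le hab).ne' ha.ne', abs_of_nonneg (sub_nonneg.2 hab)]
  linarith

lemma abs_log_sub_log_le_rpow {a b : ℝ} (ha : 0 < a) (hb : 0 < b) :
    |Real.log a - Real.log b| ≤
      2 * |a - b| ^ (1 / 2 : ℝ) * (a ^ (-(1 / 2) : ℝ) + b ^ (-(1 / 2) : ℝ)) := by
  have hpos : ∀ c : ℝ, 0 < c → 0 ≤ 2 * |a - b| ^ (1 / 2 : ℝ) * c ^ (-(1 / 2) : ℝ) :=
    fun c hc => by positivity
  rw [mul_add]
  rcases le_total a b with h | h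
  · rw [abs_sub_comm, abs_of_nonneg (sub_nonneg.2 (Real.log_le_log ha h)), abs_sub_comm a]
    have := hpos b hb
    rw [abs_sub_comm a] at this
    linarith [log_sub_log_le_rpow ha h]
  · rw [abs_of_nonneg (sub_nonneg.2 (Real.log_le_log hb h))]
    linarith [log_sub_log_le_rpow hb h, hpos a ha]

section BoundedDensity

variable {μ : Measure ℝ} {C : NNReal} (hμ : μ ≤ C • volume)

include hμ

lemma ae_ne_of_le_smul_volume (x : ℝ) : ∀ᵐ t ∂μ, x ≠ t := by
  have hx : ∀ᵐ t : ℝ, x ≠ t := by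
    filter_upwards [measure_eq_zero_iff_ae_notMem.1 (measure_singleton x)] with t ht heq
    exact ht heq.symm
  exact (Measure.absolutelyContinuous_of_le_smul hμ).ae_le hx

lemma lintegral_abs_sub_rpow_le {r : ℝ} (hr : r ≤ 0) (x : ℝ) :
    ∫⁻ t, ENNReal.ofReal (|x - t| ^ r) ∂μ ≤
      C * (∫⁻ u in Set.Icc (-1) 1, ENNReal.ofReal (|u| ^ r)) + μ Set.univ := by
  set φ : ℝ → ENNReal := (Set.Icc (-1) 1).indicator fun u => ENNReal.ofReal (|u| ^ r)
  have hle : ∀ u, ENNReal.ofReal (|u| ^ r) ≤ φ u + 1 := by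
    intro u
    by_cases hu : u ∈ Set.Icc (-1 : ℝ) 1
    · simp only [φ, Set.indicator_of_mem hu]
      exact le_self_add
    · have hu' : 1 ≤ |u| := by
        rw [Set.mem_Icc, ← abs_le, not_le] at hu
        exact hu.le
      refine le_trans ?_ le_add_self
      exact ENNReal.ofReal_le_one.2 (Real.rpow_le_one_of_one_le_of_nonpos hu' hr)
  calc ∫⁻ t, ENNReal.ofReal (|x - t| ^ r) ∂μ
      ≤ ∫⁻ t, φ (x - t) + 1 ∂μ := lintegral_mono fun t => hle (x - t)
    _ = ∫⁻ t, φ (x - t) ∂μ + μ Set.univ := by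
        rw [lintegral_add_right _ measurable_const, lintegral_one]
    _ ≤ ∫⁻ t, φ (x - t) ∂(C • volume) + μ Set.univ := by
        gcongr
    _ = C * (∫⁻ u in Set.Icc (-1) 1, ENNReal.ofReal (|u| ^ r)) + μ Set.univ := by
        rw [lintegral_smul_measure, lintegral_sub_left_eq_self φ x,
          lintegral_indicator measurableSet_Icc, ENNReal.smul_def, smul_eq_mul]

variable [IsFiniteMeasure μ]

lemma exists_integral_abs_sub_rpow_le {r : ℝ} (hr : -1 < r) (hr' : r ≤ 0) :
    ∃ K : ℝ, 0 ≤ K ∧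
      ∀ x, Integrable (fun t => |x - t| ^ r) μ ∧ ∫ t, |x - t| ^ r ∂μ ≤ K := by
  set A : ENNReal := C * (∫⁻ u in Set.Icc (-1) 1, ENNReal.ofReal (|u| ^ r)) + μ Set.univ
  have hA : A < ⊤ := ENNReal.add_lt_top.2 ⟨ENNReal.mul_lt_top ENNReal.coe_lt_top
    (integrableOn_abs_rpow hr 1).lintegral_lt_top, measure_lt_top _ _⟩
  refine ⟨A.toReal, ENNReal.toReal_nonneg, fun x => ?_⟩
  have hle := lintegral_abs_sub_rpow_le hμ hr' x
  have hmeas : AEStronglyMeasurable (fun t => |x - t| ^ r) μ :=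
    (by fun_prop : Measurable fun t => |x - t| ^ r).aestronglyMeasurable
  have hnonneg : 0 ≤ᵐ[μ] fun t => |x - t| ^ r := ae_of_all _ fun t => by positivity
  refine ⟨(lintegral_ofReal_ne_top_iff_integrable hmeas hnonneg).1 (hle.trans_lt hA).ne, ?_⟩
  rw [integral_eq_lintegral_of_nonneg_ae hnonneg hmeas]
  exact ENNReal.toReal_mono hA.ne hle

lemma integrable_prod_abs_sub_rpow {ν : Measure ℝ} [IsFiniteMeasure ν] {r : ℝ} (hr : -1 < r)
    (hr' : r ≤ 0) : Integrable (fun p : ℝ × ℝ => |p.1 - p.2| ^ r) (ν.prod μ) := by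
  obtain ⟨K, -, hK⟩ := exists_integral_abs_sub_rpow_le hμ hr hr'
  have hmeas : Measurable fun p : ℝ × ℝ => |p.1 - p.2| ^ r := by fun_prop
  refine (integrable_prod_iff hmeas.aestronglyMeasurable).2 ⟨ae_of_all _ fun x => (hK x).1, ?_⟩
  refine Integrable.of_bound
    hmeas.stronglyMeasurable.norm.integral_prod_right.aestronglyMeasurable K
    (ae_of_all _ fun x => ?_)
  have hnorm : ∀ t : ℝ, ‖|x - t| ^ r‖ = |x - t| ^ r :=
    fun t => Real.norm_of_nonneg (by positivity)
  simp only [hnorm]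
  rw [Real.norm_of_nonneg (integral_nonneg fun t => by positivity)]
  exact (hK x).2

variable {L : ℝ} (hL : ∀ᵐ t ∂μ, |t| ≤ L)

include hL

lemma hasMutualEnergy_of_le_smul_volume {ν : Measure ℝ} [IsFiniteMeasure ν] {L' : ℝ}
    (hν : ∀ᵐ t ∂ν, |t| ≤ L') : HasMutualEnergy ν μ where
  integrable := by
    refine (((integrable_prod_abs_sub_rpow hμ (ν := ν) (r := -(1 / 2)) (by norm_num)
      (by norm_num)).const_mul 2).add (integrable_const (L' + L))).mono'
        measurable_log_abs_sub.aestronglyMeasurable ?_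
    filter_upwards [ae_prod_abs_sub_le hν hL] with p hp
    rw [Real.norm_eq_abs, Real.log_abs]
    exact (abs_log_le_rpow_add _).trans (add_le_add_right hp _)
  ae_ne := by
    have hm : MeasurableSet {p : ℝ × ℝ | p.1 ≠ p.2} :=
      (measurableSet_eq_fun measurable_fst measurable_snd).compl
    exact (Measure.ae_prod_iff_ae_ae hm).2 (ae_of_all _ (ae_ne_of_le_smul_volume hμ))

lemma integrable_log_abs_sub (x : ℝ) : Integrable (fun t => Real.log |x - t|) μ := by
  obtain ⟨K, -, hK⟩ := exists_integral_abs_sub_rpow_le hμ (r := -(1 / 2)) (by norm_num)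
    (by norm_num)
  refine (((hK x).1.const_mul 2).add (integrable_const (|x| + L))).mono' ?_ ?_
  · exact (Real.measurable_log.comp (measurable_const.sub measurable_id).abs).aestronglyMeasurable
  · filter_upwards [hL] with t ht
    rw [Real.norm_eq_abs, Real.log_abs]
    exact (abs_log_le_rpow_add _).trans
      (add_le_add_right ((abs_sub _ _).trans (add_le_add_right ht _)) _)

lemma exists_abs_logPotential_sub_le :
    ∃ K, ∀ x x', |logPotential μ x - logPotential μ x'| ≤ K * |x - x'| ^ (1 / 2 : ℝ) := by
  obtain ⟨K, -, hK⟩ := exists_integral_abs_sub_rpow_le hμ (r := -(1 / 2)) (by norm_num)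
    (by norm_num)
  refine ⟨4 * K, fun x x' => ?_⟩
  have hlog := integrable_log_abs_sub hμ hL
  calc |logPotential μ x - logPotential μ x'|
      = ‖∫ t, (Real.log |x' - t| - Real.log |x - t|) ∂μ‖ := by
        rw [logPotential, logPotential, integral_sub (hlog x') (hlog x), Real.norm_eq_abs,
          sub_neg_eq_add, neg_add_eq_sub]
    _ ≤ ∫ t, ‖Real.log |x' - t| - Real.log |x - t|‖ ∂μ := norm_integral_le_integral_norm _
    _ ≤ ∫ t, 2 * |x - x'| ^ (1 / 2 : ℝ) *
          (|x' - t| ^ (-(1 / 2) : ℝ) + |x - t| ^ (-(1 / 2) : ℝ)) ∂μ := by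
        refine integral_mono_ae ((hlog x').sub (hlog x)).norm
          (((hK x').1.add (hK x).1).const_mul _) ?_
        filter_upwards [ae_ne_of_le_smul_volume hμ x, ae_ne_of_le_smul_volume hμ x'] with t ht ht'
        have hdist : |(|x' - t| - |x - t|)| ≤ |x - x'| := by
          simpa [abs_sub_comm x x'] using abs_abs_sub_abs_le_abs_sub (x' - t) (x - t)
        refine (abs_log_sub_log_le_rpow (abs_pos.2 (sub_ne_zero.2 ht'))
          (abs_pos.2 (sub_ne_zero.2 ht))).trans ?_
        gcongr
    _ ≤ 2 * |x - x'| ^ (1 / 2 : ℝ) * (K + K) := by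
        rw [integral_const_mul, integral_add (hK x').1 (hK x).1]
        gcongr
        exacts [(hK x').2, (hK x).2]
    _ = 4 * K * |x - x'| ^ (1 / 2 : ℝ) := by ring

lemma continuous_logPotential : Continuous (logPotential μ) := by
  obtain ⟨K, hK⟩ := exists_abs_logPotential_sub_le hμ hL
  refine continuous_iff_continuousAt.2 fun x => tendsto_iff_dist_tendsto_zero.2 ?_
  have hlim : Tendsto (fun x' : ℝ => K * |x' - x| ^ (1 / 2 : ℝ)) (𝓝 x) (𝓝 0) := by
    have : Continuous fun x' : ℝ => K * |x' - x| ^ (1 / 2 : ℝ) :=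
      continuous_const.mul
        ((continuous_id.sub continuous_const).abs.rpow_const fun _ => Or.inr (by norm_num))
    simpa [Real.zero_rpow] using this.tendsto x
  exact squeeze_zero (fun _ => dist_nonneg) (fun x' => hK x' x) hlim

end BoundedDensity

lemma withDensity_ofReal_le_smul_volume {m : ℝ → ℝ} {mbar : ℝ} (hle : ∀ x, m x ≤ mbar) :
    (volume.withDensity fun x => ENNReal.ofReal (m x)) ≤ mbar.toNNReal • volume := by
  have hconst : mbar.toNNReal • (volume : Measure ℝ) =
      volume.withDensity fun _ => ENNReal.ofReal mbar := by
    rw [withDensity_const]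
    rfl
  rw [hconst]
  exact withDensity_mono (ae_of_all _ fun x => ENNReal.ofReal_le_ofReal (hle x))

/-! ### Sets of zero capacity -/

lemma HasZeroCapacity.mono {A B : Set ℝ} (hB : HasZeroCapacity B) (h : A ⊆ B) :
    HasZeroCapacity A :=
  fun μ hμ K hK hKA hμK => hB μ hμ K hK (hKA.trans h) hμK

lemma cond_volume_le_smul_volume {K : Set ℝ} (hK0 : volume K ≠ 0) :
    ProbabilityTheory.cond volume K ≤ (volume K)⁻¹.toNNReal • volume := by
  have hcoe : ((volume K)⁻¹.toNNReal : ENNReal) = (volume K)⁻¹ :=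
    ENNReal.coe_toNNReal (ENNReal.inv_ne_top.2 hK0)
  change (volume K)⁻¹ • volume.restrict K ≤ ((volume K)⁻¹.toNNReal : ENNReal) • volume
  rw [hcoe]
  gcongr
  exact Measure.restrict_le_self

lemma hasMutualEnergy_cond_volume {K : Set ℝ} (hK : IsCompact K) (hK0 : volume K ≠ 0) :
    HasMutualEnergy (ProbabilityTheory.cond volume K) (ProbabilityTheory.cond volume K) := by
  have := ProbabilityTheory.cond_isProbabilityMeasure_of_finite hK0 hK.measure_ne_top
  obtain ⟨L, hL⟩ := exists_ae_abs_le_of_isCompact hK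
    (ProbabilityTheory.ae_cond_mem (μ := volume) hK.measurableSet)
  exact hasMutualEnergy_of_le_smul_volume (cond_volume_le_smul_volume hK0) hL hL

lemma HasZeroCapacity.volume_eq_zero {A : Set ℝ} (hA : HasZeroCapacity A)
    (hm : MeasurableSet A) : volume A = 0 := by
  by_contra hA0
  obtain ⟨K, hKA, hK, hpos⟩ := hm.exists_lt_isCompact (pos_iff_ne_zero.2 hA0)
  have htop := hA _
    (ProbabilityTheory.cond_isProbabilityMeasure_of_finite hpos.ne' hK.measure_ne_top) K hK hKA
    (ProbabilityTheory.ae_cond_mem hK.measurableSet)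
  rw [logEnergy_eq_mutualEnergy (hasMutualEnergy_cond_volume hK hpos.ne')] at htop
  exact EReal.coe_ne_top _ htop

/-! ### The Euler–Lagrange conditions -/

lemma exists_volume_sublevel_ne_zero (V : ℝ → ℝ) :
    ∃ N : ℕ, volume ({x | V x ≤ N} ∩ Set.Icc 0 1) ≠ 0 := by
  by_contra! hnull
  have hunion : (⋃ N : ℕ, {x | V x ≤ N} ∩ Set.Icc (0 : ℝ) 1) = Set.Icc 0 1 := by
    rw [← Set.iUnion_inter, Set.inter_eq_right]
    exact fun x _ => Set.mem_iUnion.2 (exists_nat_ge (V x))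
  simpa [hunion] using measure_iUnion_null hnull

lemma nonneg_of_forall_nonneg_add_mul {a b : ℝ} (h : ∀ t ∈ Set.Ioo (0 : ℝ) 1, 0 ≤ a + t * b) :
    0 ≤ a := by
  have hlim : Tendsto (fun t : ℝ => a + t * b) (𝓝[>] 0) (𝓝 a) := by
    have : Continuous fun t : ℝ => a + t * b := by fun_prop
    simpa using (this.tendsto 0).mono_left nhdsWithin_le_nhds
  refine ge_of_tendsto hlim ?_
  filter_upwards [Ioo_mem_nhdsGT one_pos] with t ht using h t ht

lemma isProbabilityMeasure_smul_add_smul {α : Type*} [MeasurableSpace α] (μ ν : Measure α)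
    [IsProbabilityMeasure μ] [IsProbabilityMeasure ν] {a b : ENNReal} (hab : a + b = 1) :
    IsProbabilityMeasure (a • μ + b • ν) :=
  ⟨by simpa using hab⟩

section Potential

variable {V : ℝ → ℝ} {μ ν : Measure ℝ}

lemma IsEquilibriumMeasure.two_mul_mutualEnergy_add_le (hμ : IsEquilibriumMeasure V μ)
    [IsProbabilityMeasure ν] (hμμ : HasMutualEnergy μ μ) (hμν : HasMutualEnergy μ ν)
    (hνν : HasMutualEnergy ν ν) (hVμ : Integrable V μ) (hVν : Integrable V ν) :
    2 * mutualEnergy μ μ + ∫ x, V x ∂μ ≤ 2 * mutualEnergy ν μ + ∫ x, V x ∂ν := by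
  have := hμ.1
  rw [← sub_nonneg]
  refine nonneg_of_forall_nonneg_add_mul
    (b := mutualEnergy μ μ - 2 * mutualEnergy ν μ + mutualEnergy ν ν) fun t ht => ?_
  have hsum : ENNReal.ofReal (1 - t) + ENNReal.ofReal t = 1 := by
    rw [← ENNReal.ofReal_add (by linarith [ht.2]) ht.1.le, sub_add_cancel, ENNReal.ofReal_one]
  have hleft : Integrable V (ENNReal.ofReal (1 - t) • μ) := hVμ.smul_measure ENNReal.ofReal_ne_top
  have hright : Integrable V (ENNReal.ofReal t • ν) := hVν.smul_measure ENNReal.ofReal_ne_top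
  have hmin := hμ.2 _ (isProbabilityMeasure_smul_add_smul μ ν hsum)
  rw [meanFieldEnergy_eq_coe hμμ hVμ, meanFieldEnergy_eq_coe
      (hμμ.smul_add_smul hμν hνν ENNReal.ofReal_ne_top ENNReal.ofReal_ne_top)
      (hleft.add_measure hright), EReal.coe_le_coe_iff,
    mutualEnergy_smul_add_smul hμμ hμν hνν ENNReal.ofReal_ne_top ENNReal.ofReal_ne_top,
    integral_add_measure hleft hright, integral_smul_measure, integral_smul_measure,
    ENNReal.toReal_ofReal (by linarith [ht.2]), ENNReal.toReal_ofReal ht.1.le, smul_eq_mul,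
    smul_eq_mul] at hmin
  refine nonneg_of_mul_nonneg_right (a := t) ?_ ht.1
  linear_combination hmin

variable (hV : LowerSemicontinuous V)

include hV

lemma integrable_of_lowerSemicontinuous [IsFiniteMeasure ν] {L : ℝ} (hL : ∀ᵐ t ∂ν, |t| ≤ L)
    (hfin : ∫⁻ x, ENNReal.ofReal (V x) ∂ν ≠ ⊤) : Integrable V ν := by
  obtain ⟨B, hB⟩ := (hV.lowerSemicontinuousOn _).bddBelow_of_isCompact
    (isCompact_Icc (a := -L) (b := L))
  refine ⟨hV.measurable.aestronglyMeasurable, ?_⟩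
  have hle : ∀ᵐ t ∂ν, ‖V t‖ₑ ≤ ENNReal.ofReal (V t) + ENNReal.ofReal (-B) := by
    filter_upwards [hL] with t ht
    refine (enorm_le_toENNReal_add_toENNReal_neg (V t)).trans ?_
    rw [← EReal.coe_neg, EReal.real_coe_toENNReal, EReal.real_coe_toENNReal]
    gcongr
    exact hB (Set.mem_image_of_mem V (abs_le.1 ht))
  refine (lintegral_mono_ae hle).trans_lt ?_
  rw [lintegral_add_right _ measurable_const, lintegral_const]
  exact ENNReal.add_lt_top.2 ⟨hfin.lt_top,
    ENNReal.mul_lt_top ENNReal.ofReal_lt_top (measure_lt_top _ _)⟩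

lemma integrable_of_lowerSemicontinuous_of_ae_le [IsFiniteMeasure ν] {L A : ℝ}
    (hL : ∀ᵐ t ∂ν, |t| ≤ L) (hA : ∀ᵐ t ∂ν, V t ≤ A) : Integrable V ν := by
  refine integrable_of_lowerSemicontinuous hV hL (ne_top_of_le_ne_top ?_
    (lintegral_mono_ae (hA.mono fun t ht => ENNReal.ofReal_le_ofReal ht)))
  rw [lintegral_const]
  exact ENNReal.mul_ne_top ENNReal.ofReal_ne_top (measure_ne_top _ _)

lemma IsEquilibriumMeasure.meanFieldEnergy_ne_top (hμ : IsEquilibriumMeasure V μ) :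
    meanFieldEnergy V μ ≠ ⊤ := by
  obtain ⟨N, hN⟩ := exists_volume_sublevel_ne_zero V
  have hK : IsCompact ({x | V x ≤ N} ∩ Set.Icc (0 : ℝ) 1) :=
    isCompact_Icc.inter_left (hV.isClosed_preimage (N : ℝ))
  have hprob := ProbabilityTheory.cond_isProbabilityMeasure_of_finite hN hK.measure_ne_top
  have hmem := ProbabilityTheory.ae_cond_mem (μ := volume) hK.measurableSet
  obtain ⟨L, hL⟩ := exists_ae_abs_le_of_isCompact hK hmem
  have hint := integrable_of_lowerSemicontinuous_of_ae_le hV hL (hmem.mono fun t ht => ht.1)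
  have hle := hμ.2 _ hprob
  rw [meanFieldEnergy_eq_coe (hasMutualEnergy_cond_volume hK hN) hint] at hle
  exact ne_top_of_le_ne_top (EReal.coe_ne_top _) hle

lemma IsEquilibriumMeasure.integrable_potential (hμ : IsEquilibriumMeasure V μ) {L : ℝ}
    (hL : ∀ᵐ t ∂μ, |t| ≤ L) : Integrable V μ := by
  have := hμ.1
  refine integrable_of_lowerSemicontinuous hV hL fun htop => hμ.meanFieldEnergy_ne_top hV ?_
  rw [meanFieldEnergy, if_pos htop]

end Potential

/-- The constant of the Euler–Lagrange conditions, found by integrating `U^μ + V / 2 = c` against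
the probability measure `μ`. -/
noncomputable def robinConstant (V : ℝ → ℝ) (μ : Measure ℝ) : ℝ :=
  mutualEnergy μ μ + (∫ x, V x ∂μ) / 2

section EulerLagrange

variable {V : ℝ → ℝ} (hV : LowerSemicontinuous V) {μ₀ : Measure ℝ}
  (hμ₀ : IsEquilibriumMeasure V μ₀) {C : NNReal} (hC : μ₀ ≤ C • volume) {L : ℝ}
  (hL : ∀ᵐ t ∂μ₀, |t| ≤ L)

lemma integral_logPotential_add {μ ν : Measure ℝ} [SFinite μ] [SFinite ν]
    (h : HasMutualEnergy ν μ) (hVν : Integrable V ν) :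
    ∫ x, (logPotential μ x + V x / 2) ∂ν = mutualEnergy ν μ + (∫ x, V x ∂ν) / 2 := by
  rw [integral_add h.integrable_logPotential (hVν.div_const 2), integral_div,
    ← mutualEnergy_eq_integral_logPotential h]

include hV hμ₀ hC hL

lemma robinConstant_le_integral {ν : Measure ℝ} [IsProbabilityMeasure ν] {L' : ℝ}
    (hν : ∀ᵐ t ∂ν, |t| ≤ L') (hνν : HasMutualEnergy ν ν) (hVν : Integrable V ν) :
    robinConstant V μ₀ ≤ ∫ x, (logPotential μ₀ x + V x / 2) ∂ν := by
  have := hμ₀.1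
  have hνμ := hasMutualEnergy_of_le_smul_volume hC hL hν
  have hvar := hμ₀.two_mul_mutualEnergy_add_le (hasMutualEnergy_of_le_smul_volume hC hL hL)
    hνμ.symm hνν (hμ₀.integrable_potential hV hL) hVν
  rw [integral_logPotential_add hνμ hVν, robinConstant]
  linarith

lemma hasZeroCapacity_lt_robinConstant :
    HasZeroCapacity {x | logPotential μ₀ x + V x / 2 < robinConstant V μ₀} := by
  intro ν hν K hK hKA hνK
  by_contra hne
  have := hμ₀.1
  have hmem : ∀ᵐ t ∂ν, t ∈ K := hνK
  have hlt : ∀ᵐ t ∂ν, logPotential μ₀ t + V t / 2 < robinConstant V μ₀ :=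
    hmem.mono fun t ht => hKA ht
  obtain ⟨L', hL'⟩ := exists_ae_abs_le_of_isCompact hK hmem
  obtain ⟨B, hB⟩ := hK.exists_bound_of_continuousOn (continuous_logPotential hC hL).continuousOn
  have hVν : Integrable V ν := by
    refine integrable_of_lowerSemicontinuous_of_ae_le hV hL'
      (A := 2 * (robinConstant V μ₀ + B)) ?_
    filter_upwards [hmem, hlt] with t ht hlt
    linarith [(abs_le.1 (hB t ht)).1]
  have hint : Integrable (fun x => logPotential μ₀ x + V x / 2) ν :=
    (hasMutualEnergy_of_le_smul_volume hC hL hL').integrable_logPotential.add (hVν.div_const 2)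
  have hle := robinConstant_le_integral hV hμ₀ hC hL hL'
    (hasMutualEnergy_of_logEnergy_ne_top hL' hne) hVν
  have hgap : ∫ x, (robinConstant V μ₀ - (logPotential μ₀ x + V x / 2)) ∂ν ≤ 0 := by
    rw [integral_sub (integrable_const _) hint, integral_const, probReal_univ, one_smul]
    linarith
  have hnonneg : 0 ≤ᵐ[ν] fun x => robinConstant V μ₀ - (logPotential μ₀ x + V x / 2) :=
    hlt.mono fun x hx => sub_nonneg.2 hx.le
  have hzero := (integral_eq_zero_iff_of_nonneg_ae hnonneg ((integrable_const _).sub hint)).1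
    (le_antisymm hgap (integral_nonneg_of_ae hnonneg))
  obtain ⟨x, hx, hx'⟩ := (hlt.and hzero).exists
  exact (sub_pos.2 hx).ne' hx'

lemma ae_robinConstant_le : ∀ᵐ x, robinConstant V μ₀ ≤ logPotential μ₀ x + V x / 2 := by
  have := hμ₀.1
  have hmeas : Measurable fun x => logPotential μ₀ x + V x / 2 :=
    (continuous_logPotential hC hL).measurable.add (hV.measurable.div_const 2)
  have hnull := (hasZeroCapacity_lt_robinConstant hV hμ₀ hC hL).volume_eq_zero
    (measurableSet_lt hmeas measurable_const)
  rw [ae_iff]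
  simpa using hnull

lemma ae_eq_robinConstant : ∀ᵐ x ∂μ₀, logPotential μ₀ x + V x / 2 = robinConstant V μ₀ := by
  have := hμ₀.1
  have hle : ∀ᵐ x ∂μ₀, robinConstant V μ₀ ≤ logPotential μ₀ x + V x / 2 :=
    (Measure.absolutelyContinuous_of_le_smul hC).ae_le (ae_robinConstant_le hV hμ₀ hC hL)
  have henergy := hasMutualEnergy_of_le_smul_volume hC hL hL
  have hVμ := hμ₀.integrable_potential hV hL
  have hint : Integrable (fun x => logPotential μ₀ x + V x / 2) μ₀ :=
    henergy.integrable_logPotential.add (hVμ.div_const 2)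
  have hgap : ∫ x, (logPotential μ₀ x + V x / 2 - robinConstant V μ₀) ∂μ₀ = 0 := by
    rw [integral_sub hint (integrable_const _), integral_logPotential_add henergy hVμ,
      integral_const, probReal_univ, one_smul, robinConstant, sub_self]
  have hzero := (integral_eq_zero_iff_of_nonneg_ae (hle.mono fun x hx => sub_nonneg.2 hx)
    (hint.sub (integrable_const _))).1 hgap
  exact hzero.mono fun x hx => sub_eq_zero.1 hx

lemma isEquilibriumConstant_robinConstant :
    IsEquilibriumConstant V μ₀ (robinConstant V μ₀) := by
  have := hμ₀.1
  have hcap := hasZeroCapacity_lt_robinConstant hV hμ₀ hC hL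
  have hlsc : LowerSemicontinuous fun x => logPotential μ₀ x + V x / 2 :=
    (continuous_logPotential hC hL).lowerSemicontinuous.add
      ((continuous_id.div_const (2 : ℝ)).comp_lowerSemicontinuous hV
        fun a b h => div_le_div_of_nonneg_right h zero_le_two)
  have hnull : μ₀ {x | robinConstant V μ₀ < logPotential μ₀ x + V x / 2} = 0 :=
    measure_mono_null (fun _ hx => (Set.mem_ofPred_eq ▸ hx).ne')
      (ae_iff.1 (ae_eq_robinConstant hV hμ₀ hC hL))
  have hsupp := Measure.subset_compl_support_of_isOpen (hlsc.isOpen_preimage _) hnull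
  refine ⟨hcap.mono ?_, hcap.mono fun x hx => not_le.1 hx.2⟩
  rintro x ⟨hx, hne⟩
  exact lt_of_le_of_ne (not_lt.1 fun hgt => hsupp hgt hx) hne

lemma IsEquilibriumConstant.eq_robinConstant {c : ℝ} (hc : IsEquilibriumConstant V μ₀ c) :
    c = robinConstant V μ₀ := by
  have := hμ₀.1
  have hmeas : Measurable fun x => logPotential μ₀ x + V x / 2 :=
    (continuous_logPotential hC hL).measurable.add (hV.measurable.div_const 2)
  have hnull := hc.1.volume_eq_zero (Measure.isClosed_support.measurableSet.inter
    (measurableSet_eq_fun hmeas measurable_const).compl)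
  have hae : ∀ᵐ x ∂μ₀, ¬ (x ∈ μ₀.support ∧ ¬ logPotential μ₀ x + V x / 2 = c) :=
    (Measure.absolutelyContinuous_of_le_smul hC).ae_le (measure_eq_zero_iff_ae_notMem.1 hnull)
  obtain ⟨x, ⟨hx, hsupp⟩, heq⟩ :=
    ((hae.and Measure.support_mem_ae).and (ae_eq_robinConstant hV hμ₀ hC hL)).exists
  rw [← heq]
  by_contra hne
  exact hx ⟨hsupp, fun heq => hne heq.symm⟩

end EulerLagrange

/-! ### The integral of `Re ((z - s)⁻¹ conj (z - t)⁻¹)` over a horizontal strip -/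

/-- The real part of `(z - s)⁻¹ conj (z - t)⁻¹` at `z = x + i y`. -/
noncomputable def pairKernel (s t x y : ℝ) : ℝ :=
  ((x - s) * (x - t) + y ^ 2) / (((x - s) ^ 2 + y ^ 2) * ((x - t) ^ 2 + y ^ 2))

lemma re_inv_mul_conj_inv (s t : ℝ) (z : ℂ) :
    ((z - s)⁻¹ * (starRingEnd ℂ) ((z - t)⁻¹)).re = pairKernel s t z.re z.im := by
  rw [pairKernel, div_eq_mul_inv, mul_inv]
  simp [Complex.inv_re, Complex.inv_im, Complex.normSq_apply]
  ring

lemma pairKernel_self (s x : ℝ) {y : ℝ} (hy : y ≠ 0) :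
    pairKernel s s x y = ((x - s) ^ 2 + y ^ 2)⁻¹ := by
  rw [pairKernel, ← sq (x - s), div_mul_cancel_left₀ (by positivity)]

lemma pairKernel_abs (s t x y : ℝ) : pairKernel s t x |y| = pairKernel s t x y := by
  simp only [pairKernel, sq_abs]

lemma abs_pairKernel_le (s t x y : ℝ) :
    |pairKernel s t x y| ≤ ((x - s) ^ 2 + y ^ 2)⁻¹ + ((x - t) ^ 2 + y ^ 2)⁻¹ := by
  have norm_inv_sq (u : ℝ) : ‖((⟨x, y⟩ : ℂ) - u)⁻¹‖ ^ 2 = ((x - u) ^ 2 + y ^ 2)⁻¹ := by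
    rw [← Complex.normSq_eq_norm_sq, map_inv₀, Complex.normSq_apply]
    simp [sq]
  rw [← re_inv_mul_conj_inv s t ⟨x, y⟩, ← norm_inv_sq, ← norm_inv_sq]
  refine (Complex.abs_re_le_norm _).trans ?_
  rw [norm_mul, RCLike.norm_conj]
  nlinarith [sq_nonneg (‖((⟨x, y⟩ : ℂ) - s)⁻¹‖ - ‖((⟨x, y⟩ : ℂ) - t)⁻¹‖),
    norm_nonneg ((⟨x, y⟩ : ℂ) - s)⁻¹, norm_nonneg ((⟨x, y⟩ : ℂ) - t)⁻¹]

lemma measurable_pairKernel {α : Type*} [MeasurableSpace α] {s t x y : α → ℝ} (hs : Measurable s)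
    (ht : Measurable t) (hx : Measurable x) (hy : Measurable y) :
    Measurable fun a => pairKernel (s a) (t a) (x a) (y a) := by
  unfold pairKernel
  fun_prop

lemma integrable_inv_sq_add_sq (s : ℝ) {y : ℝ} (hy : y ≠ 0) :
    Integrable fun x : ℝ => ((x - s) ^ 2 + y ^ 2)⁻¹ := by
  refine (((integrable_inv_one_add_sq.comp_div hy).const_mul (y ^ 2)⁻¹).comp_sub_right s).congr
    (ae_of_all _ fun x => ?_)
  simp only
  rw [← mul_inv]
  congr 1
  field_simp
  ring

lemma integrable_pairKernel (s t : ℝ) {y : ℝ} (hy : y ≠ 0) :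
    Integrable fun x : ℝ => pairKernel s t x y :=
  ((integrable_inv_sq_add_sq s hy).add (integrable_inv_sq_add_sq t hy)).mono'
    (measurable_pairKernel measurable_const measurable_const measurable_id
      measurable_const).aestronglyMeasurable
    (ae_of_all _ fun x => abs_pairKernel_le s t x y)

/-- A primitive of `x ↦ pairKernel s t x y`, found by partial fractions. -/
noncomputable def pairKernelPrimitive (s t y x : ℝ) : ℝ :=
  ((s - t) ^ 2 + 4 * y ^ 2)⁻¹ *
    ((t - s) / 2 * (Real.log ((x - t) ^ 2 + y ^ 2) - Real.log ((x - s) ^ 2 + y ^ 2)) +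
      2 * y * (Real.arctan ((x - t) / y) + Real.arctan ((x - s) / y)))

lemma hasDerivAt_log_sub_sq_add_sq (u x : ℝ) {y : ℝ} (hy : y ≠ 0) :
    HasDerivAt (fun x : ℝ => Real.log ((x - u) ^ 2 + y ^ 2))
      (2 * (x - u) / ((x - u) ^ 2 + y ^ 2)) x := by
  have hquad : HasDerivAt (fun x : ℝ => (x - u) ^ 2 + y ^ 2) (2 * (x - u)) x := by
    simpa using (((hasDerivAt_id x).sub_const u).pow 2).add_const (y ^ 2)
  exact hquad.log (by positivity)

lemma hasDerivAt_arctan_sub_div (u x : ℝ) {y : ℝ} (hy : y ≠ 0) :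
    HasDerivAt (fun x : ℝ => Real.arctan ((x - u) / y)) (y / ((x - u) ^ 2 + y ^ 2)) x := by
  refine (((hasDerivAt_id x).sub_const u).div_const y).arctan.congr_deriv ?_
  have : (x - u) ^ 2 + y ^ 2 ≠ 0 := by positivity
  have : 1 + ((x - u) / y) ^ 2 = ((x - u) ^ 2 + y ^ 2) / y ^ 2 := by field_simp; ring
  rw [id, this]
  field_simp

lemma hasDerivAt_pairKernelPrimitive (s t x : ℝ) {y : ℝ} (hy : y ≠ 0) :
    HasDerivAt (pairKernelPrimitive s t y) (pairKernel s t x y) x := by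
  refine (((((hasDerivAt_log_sub_sq_add_sq t x hy).sub
    (hasDerivAt_log_sub_sq_add_sq s x hy)).const_mul ((t - s) / 2)).add
    (((hasDerivAt_arctan_sub_div t x hy).add
      (hasDerivAt_arctan_sub_div s x hy)).const_mul (2 * y))).const_mul
    ((s - t) ^ 2 + 4 * y ^ 2)⁻¹).congr_deriv ?_
  have : (x - s) ^ 2 + y ^ 2 ≠ 0 := by positivity
  have : (x - t) ^ 2 + y ^ 2 ≠ 0 := by positivity
  rw [pairKernel, inv_mul_eq_div, div_eq_iff (by positivity)]
  field_simp
  ring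

section

variable {l : Filter ℝ} (hinv : Tendsto (fun x : ℝ => x⁻¹) l (𝓝 0)) (hne : ∀ᶠ x in l, x ≠ 0)
include hinv hne

lemma tendsto_log_sub_sq_add_sq_sub_log_sq (u y : ℝ) :
    Tendsto (fun x : ℝ => Real.log ((x - u) ^ 2 + y ^ 2) - Real.log (x ^ 2)) l (𝓝 0) := by
  have hratio : Tendsto (fun x : ℝ => (1 - u * x⁻¹) ^ 2 + (y * x⁻¹) ^ 2) l (𝓝 1) := by
    simpa using (((hinv.const_mul u).const_sub 1).pow 2).add ((hinv.const_mul y).pow 2)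
  refine (Real.log_one ▸ hratio.log one_ne_zero).congr' ?_
  filter_upwards [hne, hratio.eventually_ne one_ne_zero] with x hx hx'
  have : (x - u) ^ 2 + y ^ 2 = x ^ 2 * ((1 - u * x⁻¹) ^ 2 + (y * x⁻¹) ^ 2) := by field_simp
  rw [this, Real.log_mul (pow_ne_zero 2 hx) hx', add_sub_cancel_left]

lemma tendsto_pairKernelPrimitive (s t : ℝ) {y c : ℝ}
    (harctan : ∀ u, Tendsto (fun x => Real.arctan ((x - u) / y)) l (𝓝 c)) :
    Tendsto (pairKernelPrimitive s t y) l (𝓝 (((s - t) ^ 2 + 4 * y ^ 2)⁻¹ * (4 * y * c))) := by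
  have hlog : Tendsto (fun x : ℝ => Real.log ((x - t) ^ 2 + y ^ 2) -
      Real.log ((x - s) ^ 2 + y ^ 2)) l (𝓝 0) := by
    simpa using (tendsto_log_sub_sq_add_sq_sub_log_sq hinv hne t y).sub
      (tendsto_log_sub_sq_add_sq_sub_log_sq hinv hne s y)
  rw [show 4 * y * c = (t - s) / 2 * 0 + 2 * y * (c + c) by ring]
  exact ((hlog.const_mul _).add (((harctan t).add (harctan s)).const_mul _)).const_mul _

end

lemma integral_pairKernel_of_pos (s t : ℝ) {y : ℝ} (hy : 0 < y) :
    ∫ x : ℝ, pairKernel s t x y = 4 * Real.pi * y / ((s - t) ^ 2 + 4 * y ^ 2) := by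
  have htop := tendsto_pairKernelPrimitive tendsto_inv_atTop_zero (eventually_ne_atTop 0) s t
    fun u => (Real.tendsto_arctan_atTop.mono_right nhdsWithin_le_nhds).comp
      ((tendsto_atTop_add_const_right _ (-u) tendsto_id).atTop_div_const hy)
  have hbot := tendsto_pairKernelPrimitive tendsto_inv_atBot_zero (eventually_ne_atBot 0) s t
    fun u => (Real.tendsto_arctan_atBot.mono_right nhdsWithin_le_nhds).comp
      ((tendsto_atBot_add_const_right _ (-u) tendsto_id).atBot_div_const hy)
  rw [integral_of_hasDerivAt_of_tendsto (fun x => hasDerivAt_pairKernelPrimitive s t x hy.ne')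
    (integrable_pairKernel s t hy.ne') hbot htop]
  field_simp
  ring

lemma integral_pairKernel (s t : ℝ) {y : ℝ} (hy : y ≠ 0) :
    ∫ x : ℝ, pairKernel s t x y = 4 * Real.pi * |y| / ((s - t) ^ 2 + 4 * |y| ^ 2) := by
  simp only [← integral_pairKernel_of_pos s t (abs_pos.2 hy), pairKernel_abs]

/-- The symmetric strip `δ < |Im z| < Y`. -/
def strip (δ Y : ℝ) : Set ℂ := {z | |z.im| ∈ Set.Ioo δ Y}

lemma measurableSet_abs_preimage_Ioo (δ Y : ℝ) : MeasurableSet (abs ⁻¹' Set.Ioo δ Y) :=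
  measurableSet_preimage measurable_id.abs measurableSet_Ioo

lemma measurableSet_strip (δ Y : ℝ) : MeasurableSet (strip δ Y) :=
  measurableSet_preimage Complex.measurable_im.abs measurableSet_Ioo

lemma im_ne_zero_of_mem_strip {δ Y : ℝ} (hδ : 0 < δ) {z : ℂ} (hz : z ∈ strip δ Y) : z.im ≠ 0 :=
  abs_pos.1 (hδ.trans hz.1)

instance isFiniteMeasure_restrict_abs_preimage_Ioo (δ Y : ℝ) :
    IsFiniteMeasure ((volume : Measure ℝ).restrict (abs ⁻¹' Set.Ioo δ Y)) :=
  isFiniteMeasure_restrict.2 <| ne_top_of_le_ne_top (by simp)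
    (measure_mono (t := Set.Icc (-Y) Y) fun _ hy => abs_le.1 hy.2.le)

lemma measurePreserving_strip (δ Y : ℝ) :
    MeasurePreserving Complex.measurableEquivRealProd (volume.restrict (strip δ Y))
      (volume.prod (volume.restrict (abs ⁻¹' Set.Ioo δ Y))) := by
  have h := Complex.volume_preserving_equiv_real_prod.restrict_preimage
    (MeasurableSet.univ.prod (measurableSet_abs_preimage_Ioo δ Y))
  rw [Measure.volume_eq_prod, ← Measure.prod_restrict, Measure.restrict_univ, Set.univ_prod] at h
  exact h

section

variable {δ Y : ℝ} (hδ : 0 < δ)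
include hδ

lemma integrable_inv_sq_add_sq_prod (s : ℝ) :
    Integrable (fun p : ℝ × ℝ => ((p.1 - s) ^ 2 + p.2 ^ 2)⁻¹)
      (volume.prod (volume.restrict (abs ⁻¹' Set.Ioo δ Y))) := by
  refine ((integrable_inv_sq_add_sq s hδ.ne').mul_prod (integrable_const (1 : ℝ))).mono'
    (by fun_prop) ?_
  filter_upwards [Measure.quasiMeasurePreserving_snd.ae
    (ae_restrict_mem (measurableSet_abs_preimage_Ioo δ Y))] with p hp
  rw [mul_one, Real.norm_of_nonneg (by positivity), ← sq_abs p.2]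
  have := hp.1
  gcongr

lemma integrable_pairKernel_prod (s t : ℝ) :
    Integrable (fun p : ℝ × ℝ => pairKernel s t p.1 p.2)
      (volume.prod (volume.restrict (abs ⁻¹' Set.Ioo δ Y))) :=
  ((integrable_inv_sq_add_sq_prod hδ s).add (integrable_inv_sq_add_sq_prod hδ t)).mono'
    (measurable_pairKernel measurable_const measurable_const measurable_fst
      measurable_snd).aestronglyMeasurable
    (ae_of_all _ fun p => abs_pairKernel_le s t p.1 p.2)

lemma integrableOn_strip_pairKernel (s t : ℝ) :
    IntegrableOn (fun z : ℂ => pairKernel s t z.re z.im) (strip δ Y) :=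
  (measurePreserving_strip δ Y).integrable_comp_of_integrable (integrable_pairKernel_prod hδ s t)

variable (hY : δ ≤ Y)
include hY

lemma integral_Ioo_div_sq_add_four_mul_sq (a : ℝ) :
    ∫ y in Set.Ioo δ Y, 8 * y / (a ^ 2 + 4 * y ^ 2) =
      Real.log (a ^ 2 + 4 * Y ^ 2) - Real.log (a ^ 2 + 4 * δ ^ 2) := by
  have hpos : ∀ y ∈ Set.uIcc δ Y, 0 < a ^ 2 + 4 * y ^ 2 := by
    intro y hy
    have := hδ.trans_le (Set.uIcc_of_le hY ▸ hy).1
    positivity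
  rw [← integral_Ioc_eq_integral_Ioo, ← intervalIntegral.integral_of_le hY]
  have hcont : ContinuousOn (fun y => 8 * y / (a ^ 2 + 4 * y ^ 2)) (Set.uIcc δ Y) :=
    ContinuousOn.div (by fun_prop) (by fun_prop) fun y hy => (hpos y hy).ne'
  refine intervalIntegral.integral_eq_sub_of_hasDerivAt
    (f := fun y => Real.log (a ^ 2 + 4 * y ^ 2)) (fun y hy => ?_) hcont.intervalIntegrable
  have hquad : HasDerivAt (fun y : ℝ => a ^ 2 + 4 * y ^ 2) (8 * y) y :=
    ((((hasDerivAt_id y).pow 2).const_mul 4).const_add (a ^ 2)).congr_deriv (by simp; ring)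
  exact hquad.log (hpos y hy).ne'

lemma integral_strip_pairKernel (s t : ℝ) :
    ∫ z in strip δ Y, pairKernel s t z.re z.im =
      Real.pi * (Real.log ((s - t) ^ 2 + 4 * Y ^ 2) - Real.log ((s - t) ^ 2 + 4 * δ ^ 2)) := by
  set f : ℝ → ℝ := fun y => 4 * Real.pi * y / ((s - t) ^ 2 + 4 * y ^ 2)
  calc ∫ z in strip δ Y, pairKernel s t z.re z.im
      = ∫ y in abs ⁻¹' Set.Ioo δ Y, ∫ x, pairKernel s t x y := by
        rw [← integral_prod_symm _ (integrable_pairKernel_prod hδ s t)]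
        exact (measurePreserving_strip δ Y).integral_comp
          Complex.measurableEquivRealProd.measurableEmbedding fun p => pairKernel s t p.1 p.2
    _ = ∫ y in abs ⁻¹' Set.Ioo δ Y, f |y| :=
        setIntegral_congr_fun (measurableSet_abs_preimage_Ioo δ Y)
          fun y hy => integral_pairKernel s t (abs_pos.1 (hδ.trans hy.1))
    _ = 2 * ∫ y in Set.Ioo δ Y, f y := by
        rw [← integral_indicator (measurableSet_abs_preimage_Ioo δ Y)]
        change ∫ y, (Set.indicator (abs ⁻¹' Set.Ioo δ Y) (f ∘ abs)) y = _
        simp only [Set.indicator_comp_right]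
        rw [integral_comp_abs (f := (Set.Ioo δ Y).indicator f),
          setIntegral_indicator measurableSet_Ioo,
          Set.inter_eq_right.2 fun y (hy : y ∈ Set.Ioo δ Y) => Set.mem_Ioi.2 (hδ.trans hy.1)]
    _ = _ := by
        rw [← integral_Ioo_div_sq_add_four_mul_sq hδ hY, ← integral_const_mul,
          ← integral_const_mul]
        congr 1 with y
        simp only [f]
        ring

end

/-! ### The energy of Cauchy transforms on horizontal strips -/

/-- The Cauchy transform `∫ dμ(t) / (z - t)`. -/
noncomputable def cauchyTransform (μ : Measure ℝ) (z : ℂ) : ℂ := ∫ t, (z - (t : ℂ))⁻¹ ∂μ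

lemma abs_im_le_norm_sub_ofReal (z : ℂ) (t : ℝ) : |z.im| ≤ ‖z - t‖ := by
  simpa using Complex.abs_im_le_norm (z - t)

lemma integrable_inv_sub_ofReal (μ : Measure ℝ) [IsFiniteMeasure μ] {z : ℂ} (hz : z.im ≠ 0) :
    Integrable (fun t : ℝ => (z - (t : ℂ))⁻¹) μ := by
  refine Integrable.of_bound (by fun_prop) |z.im|⁻¹ (ae_of_all _ fun t => ?_)
  rw [norm_inv]
  exact inv_anti₀ (abs_pos.2 hz) (abs_im_le_norm_sub_ofReal z t)

lemma stronglyMeasurable_cauchyTransform (μ : Measure ℝ) [SFinite μ] :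
    StronglyMeasurable (cauchyTransform μ) :=
  (by fun_prop : Measurable fun p : ℂ × ℝ =>
    (p.1 - (p.2 : ℂ))⁻¹).stronglyMeasurable.integral_prod_right

section

variable (μ ν : Measure ℝ) [IsFiniteMeasure μ] [IsFiniteMeasure ν]

lemma re_cauchyTransform_mul_conj {z : ℂ} (hz : z.im ≠ 0) :
    (cauchyTransform μ z * (starRingEnd ℂ) (cauchyTransform ν z)).re =
      ∫ p, pairKernel p.1 p.2 z.re z.im ∂μ.prod ν := by
  have hint : Integrable (fun p : ℝ × ℝ => (z - (p.1 : ℂ))⁻¹ * (starRingEnd ℂ) ((z - (p.2 : ℂ))⁻¹))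
      (μ.prod ν) := (integrable_inv_sub_ofReal μ hz).mul_prod
    (Complex.conjCLE.toContinuousLinearMap.integrable_comp (integrable_inv_sub_ofReal ν hz))
  rw [cauchyTransform, cauchyTransform, ← integral_conj, ← integral_prod_mul]
  refine (Complex.reCLM.integral_comp_comm hint).symm.trans ?_
  exact integral_congr_ae (ae_of_all _ fun p => re_inv_mul_conj_inv p.1 p.2 z)

lemma setIntegral_strip_abs_pairKernel_le (s t : ℝ) {δ Y : ℝ} (hδ : 0 < δ) (hY : δ ≤ Y) :
    ∫ z in strip δ Y, |pairKernel s t z.re z.im| ≤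
      2 * Real.pi * (Real.log (4 * Y ^ 2) - Real.log (4 * δ ^ 2)) := by
  have hint (s t : ℝ) := integrableOn_strip_pairKernel (Y := Y) hδ s t
  calc ∫ z in strip δ Y, |pairKernel s t z.re z.im|
      ≤ ∫ z in strip δ Y, (pairKernel s s z.re z.im + pairKernel t t z.re z.im) := by
        refine setIntegral_mono_on (hint _ _).abs ((hint _ _).add (hint _ _))
          (measurableSet_strip δ Y) fun z hz => ?_
        have hz := im_ne_zero_of_mem_strip hδ hz
        rw [pairKernel_self _ _ hz, pairKernel_self _ _ hz]
        exact abs_pairKernel_le _ _ _ _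
    _ = _ := by
        simp only [integral_add (hint s s) (hint t t), integral_strip_pairKernel hδ hY, sub_self]
        ring_nf

lemma integrable_pairKernel_strip_prod {δ Y : ℝ} (hδ : 0 < δ) (hY : δ ≤ Y) :
    Integrable (fun q : ℂ × (ℝ × ℝ) => pairKernel q.2.1 q.2.2 q.1.re q.1.im)
      ((volume.restrict (strip δ Y)).prod (μ.prod ν)) := by
  have hmeas : Measurable fun q : ℂ × (ℝ × ℝ) => pairKernel q.2.1 q.2.2 q.1.re q.1.im :=
    measurable_pairKernel (by fun_prop) (by fun_prop) (by fun_prop) (by fun_prop)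
  rw [integrable_prod_iff' hmeas.aestronglyMeasurable]
  refine ⟨ae_of_all _ fun p => integrableOn_strip_pairKernel hδ p.1 p.2,
    Integrable.of_bound hmeas.stronglyMeasurable.norm.integral_prod_left.aestronglyMeasurable
      (2 * Real.pi * (Real.log (4 * Y ^ 2) - Real.log (4 * δ ^ 2))) (ae_of_all _ fun p => ?_)⟩
  rw [Real.norm_of_nonneg (integral_nonneg fun _ => norm_nonneg _)]
  exact setIntegral_strip_abs_pairKernel_le p.1 p.2 hδ hY

lemma ae_strip_integral_pairKernel_eq {δ Y : ℝ} (hδ : 0 < δ) :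
    (fun z : ℂ => ∫ p, pairKernel p.1 p.2 z.re z.im ∂μ.prod ν) =ᵐ[volume.restrict (strip δ Y)]
      fun z => (cauchyTransform μ z * (starRingEnd ℂ) (cauchyTransform ν z)).re := by
  filter_upwards [ae_restrict_mem (measurableSet_strip δ Y)] with z hz
  exact (re_cauchyTransform_mul_conj μ ν (im_ne_zero_of_mem_strip hδ hz)).symm

lemma integrableOn_strip_re_cauchyTransform_mul_conj {δ Y : ℝ} (hδ : 0 < δ) (hY : δ ≤ Y) :
    IntegrableOn (fun z => (cauchyTransform μ z * (starRingEnd ℂ) (cauchyTransform ν z)).re)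
      (strip δ Y) :=
  (integrable_pairKernel_strip_prod μ ν hδ hY).integral_prod_left.congr
    (ae_strip_integral_pairKernel_eq μ ν hδ)

end

/-- The mutual energy `∬ log ((s - t)² + 4 ε²) dμ(s) dν(t)`. The smoothed logarithm is what
integrating `pairKernel` down to height `ε` produces; it tends to `2 log |s - t|` with `ε`. -/
noncomputable def smearedEnergy (ε : ℝ) (μ ν : Measure ℝ) : ℝ :=
  ∫ p, Real.log ((p.1 - p.2) ^ 2 + 4 * ε ^ 2) ∂μ.prod ν

lemma abs_log_sq_add_sub_log_le {u D ε : ℝ} (hu : |u| ≤ D) (hε : 0 < ε) :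
    |Real.log (u ^ 2 + 4 * ε ^ 2) - Real.log (4 * ε ^ 2)| ≤ D ^ 2 / (4 * ε ^ 2) := by
  rw [← Real.log_div (by positivity) (by positivity), abs_of_nonneg]
  · calc Real.log ((u ^ 2 + 4 * ε ^ 2) / (4 * ε ^ 2))
        ≤ (u ^ 2 + 4 * ε ^ 2) / (4 * ε ^ 2) - 1 := Real.log_le_sub_one_of_pos (by positivity)
      _ = |u| ^ 2 / (4 * ε ^ 2) := by rw [sq_abs]; field_simp; ring
      _ ≤ _ := by gcongr
  · refine Real.log_nonneg ((one_le_div₀ (by positivity)).2 ?_)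
    linarith [sq_nonneg u]

lemma abs_log_sq_add_le {u D δ : ℝ} (hu : u ≠ 0) (hD : |u| ≤ D) (hδ : |δ| ≤ 1) :
    |Real.log (u ^ 2 + 4 * δ ^ 2)| ≤ 2 * |Real.log (|u|)| + |Real.log (D ^ 2 + 4)| := by
  have hlower : 2 * Real.log |u| ≤ Real.log (u ^ 2 + 4 * δ ^ 2) := by
    rw [← Nat.cast_ofNat, ← Real.log_pow, sq_abs]
    exact Real.log_le_log (by positivity) (by linarith [sq_nonneg δ])
  have hupper : Real.log (u ^ 2 + 4 * δ ^ 2) ≤ Real.log (D ^ 2 + 4) := by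
    have hu2 : u ^ 2 ≤ D ^ 2 := sq_abs u ▸ by gcongr
    have hδ2 : δ ^ 2 ≤ 1 := (sq_le_one_iff_abs_le_one δ).2 hδ
    exact Real.log_le_log (by positivity) (by linarith)
  rw [abs_le]
  constructor
  · linarith [neg_abs_le (Real.log |u|), abs_nonneg (Real.log (D ^ 2 + 4))]
  · linarith [le_abs_self (Real.log (D ^ 2 + 4)), abs_nonneg (Real.log |u|)]

lemma tendsto_log_sq_add_four_mul_sq {u : ℝ} (hu : u ≠ 0) :
    Tendsto (fun δ : ℝ => Real.log (u ^ 2 + 4 * δ ^ 2)) (𝓝[>] 0) (𝓝 (2 * Real.log |u|)) := by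
  have hcont : ContinuousAt (fun δ : ℝ => Real.log (u ^ 2 + 4 * δ ^ 2)) 0 :=
    ContinuousAt.log (by fun_prop) (by positivity)
  have hval : Real.log (u ^ 2 + 4 * 0 ^ 2) = 2 * Real.log |u| := by simp
  exact hval ▸ hcont.tendsto.mono_left nhdsWithin_le_nhds

lemma measurable_log_sub_sq_add (ε : ℝ) :
    Measurable fun p : ℝ × ℝ => Real.log ((p.1 - p.2) ^ 2 + 4 * ε ^ 2) :=
  Measurable.log (by fun_prop)

section

variable {μ ν : Measure ℝ} [IsFiniteMeasure μ] [IsFiniteMeasure ν] {D : ℝ}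
  (hD : ∀ᵐ p ∂μ.prod ν, |p.1 - p.2| ≤ D)
include hD

lemma integrable_log_sub_sq_add {ε : ℝ} (hε : 0 < ε) :
    Integrable (fun p : ℝ × ℝ => Real.log ((p.1 - p.2) ^ 2 + 4 * ε ^ 2)) (μ.prod ν) := by
  have hsub : Integrable (fun p : ℝ × ℝ => Real.log ((p.1 - p.2) ^ 2 + 4 * ε ^ 2) -
      Real.log (4 * ε ^ 2)) (μ.prod ν) :=
    Integrable.of_bound ((measurable_log_sub_sq_add ε).sub_const _).aestronglyMeasurable _
      (hD.mono fun p hp => abs_log_sq_add_sub_log_le hp hε)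
  exact (hsub.add (integrable_const (Real.log (4 * ε ^ 2)))).congr
    (ae_of_all _ fun p => sub_add_cancel _ _)

lemma integral_strip_cauchyTransform {δ Y : ℝ} (hδ : 0 < δ) (hY : δ ≤ Y) :
    ∫ z in strip δ Y, (cauchyTransform μ z * (starRingEnd ℂ) (cauchyTransform ν z)).re =
      Real.pi * (smearedEnergy Y μ ν - smearedEnergy δ μ ν) := by
  rw [← integral_congr_ae (ae_strip_integral_pairKernel_eq μ ν hδ),
    integral_integral_swap (integrable_pairKernel_strip_prod μ ν hδ hY)]
  simp only [integral_strip_pairKernel hδ hY]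
  rw [integral_const_mul, integral_sub (integrable_log_sub_sq_add hD (hδ.trans_le hY))
    (integrable_log_sub_sq_add hD hδ)]
  rfl

lemma tendsto_smearedEnergy_atTop :
    Tendsto (fun Y => smearedEnergy Y μ ν -
      Real.log (4 * Y ^ 2) * (μ.real Set.univ * ν.real Set.univ)) atTop (𝓝 0) := by
  have hbound : Tendsto (fun Y : ℝ => D ^ 2 / (4 * Y ^ 2) * (μ.prod ν).real Set.univ)
      atTop (𝓝 0) := by
    simpa using ((tendsto_const_nhds (x := D ^ 2)).div_atTop
      ((tendsto_pow_atTop (α := ℝ) two_ne_zero).const_mul_atTop four_pos)).mul_const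
        ((μ.prod ν).real Set.univ)
  refine squeeze_zero_norm' ?_ hbound
  filter_upwards [eventually_gt_atTop 0] with Y hY
  have : smearedEnergy Y μ ν - Real.log (4 * Y ^ 2) * (μ.real Set.univ * ν.real Set.univ) =
      ∫ p, (Real.log ((p.1 - p.2) ^ 2 + 4 * Y ^ 2) - Real.log (4 * Y ^ 2)) ∂μ.prod ν := by
    rw [integral_sub (integrable_log_sub_sq_add hD hY) (integrable_const _), integral_const,
      smul_eq_mul, mul_comm, ← measureReal_prod_prod, Set.univ_prod_univ, smearedEnergy]
  rw [this]
  exact norm_integral_le_of_norm_le_const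
    (hD.mono fun p hp => abs_log_sq_add_sub_log_le hp hY)

lemma tendsto_smearedEnergy_zero (h : HasMutualEnergy μ ν) :
    Tendsto (fun δ => smearedEnergy δ μ ν) (𝓝[>] 0) (𝓝 (-2 * mutualEnergy μ ν)) := by
  have hval : -2 * mutualEnergy μ ν = ∫ p, 2 * Real.log |p.1 - p.2| ∂μ.prod ν := by
    rw [mutualEnergy, integral_neg, integral_const_mul]; ring
  rw [hval]
  refine tendsto_integral_filter_of_dominated_convergence
    (fun p : ℝ × ℝ => 2 * |Real.log (|p.1 - p.2|)| + |Real.log (D ^ 2 + 4)|)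
    (Eventually.of_forall fun δ => (measurable_log_sub_sq_add δ).aestronglyMeasurable) ?_
    ((h.integrable.abs.const_mul 2).add (integrable_const _)) ?_
  · filter_upwards [Ioo_mem_nhdsGT one_pos] with δ hδ
    filter_upwards [h.ae_ne, hD] with p hp hpD
    exact abs_log_sq_add_le (sub_ne_zero.2 hp) hpD (abs_le.2 ⟨by linarith [hδ.1], hδ.2.le⟩)
  · filter_upwards [h.ae_ne] with p hp
    exact tendsto_log_sq_add_four_mul_sq (sub_ne_zero.2 hp)

end

/-- The smeared energy of the signed measure `μ - ν`. -/
noncomputable def smearedEnergySub (ε : ℝ) (μ ν : Measure ℝ) : ℝ :=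
  smearedEnergy ε μ μ - 2 * smearedEnergy ε μ ν + smearedEnergy ε ν ν

section

variable {μ ν : Measure ℝ} [IsFiniteMeasure μ] [IsFiniteMeasure ν] {L : ℝ}
  (hμ : ∀ᵐ t ∂μ, |t| ≤ L) (hν : ∀ᵐ t ∂ν, |t| ≤ L)
include hμ hν

lemma integral_strip_norm_cauchyTransform_sub_sq {δ Y : ℝ} (hδ : 0 < δ) (hY : δ ≤ Y) :
    ∫ z in strip δ Y, ‖cauchyTransform μ z - cauchyTransform ν z‖ ^ 2 =
      Real.pi * (smearedEnergySub Y μ ν - smearedEnergySub δ μ ν) := by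
  have hexpand (z : ℂ) : ‖cauchyTransform μ z - cauchyTransform ν z‖ ^ 2 =
      (cauchyTransform μ z * (starRingEnd ℂ) (cauchyTransform μ z)).re -
        2 * (cauchyTransform μ z * (starRingEnd ℂ) (cauchyTransform ν z)).re +
        (cauchyTransform ν z * (starRingEnd ℂ) (cauchyTransform ν z)).re := by
    rw [← Complex.normSq_eq_norm_sq, Complex.normSq_apply]
    simp only [Complex.sub_re, Complex.sub_im, Complex.mul_re, Complex.conj_re, Complex.conj_im]
    ring
  have hμν := (integrableOn_strip_re_cauchyTransform_mul_conj μ ν hδ hY).const_mul 2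
  have hμμ := integrableOn_strip_re_cauchyTransform_mul_conj μ μ hδ hY
  simp only [hexpand]
  refine (integral_add (hμμ.sub hμν)
    (integrableOn_strip_re_cauchyTransform_mul_conj ν ν hδ hY)).trans ?_
  rw [integral_sub' hμμ hμν, integral_const_mul,
    integral_strip_cauchyTransform (ae_prod_abs_sub_le hμ hμ) hδ hY,
    integral_strip_cauchyTransform (ae_prod_abs_sub_le hμ hν) hδ hY,
    integral_strip_cauchyTransform (ae_prod_abs_sub_le hν hν) hδ hY]
  simp only [smearedEnergySub]
  ring

lemma tendsto_smearedEnergySub_atTop (hmass : μ.real Set.univ = ν.real Set.univ) :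
    Tendsto (fun Y => smearedEnergySub Y μ ν) atTop (𝓝 0) := by
  have h := ((tendsto_smearedEnergy_atTop (ae_prod_abs_sub_le hμ hμ)).sub
    ((tendsto_smearedEnergy_atTop (ae_prod_abs_sub_le hμ hν)).const_mul 2)).add
    (tendsto_smearedEnergy_atTop (ae_prod_abs_sub_le hν hν))
  rw [hmass, mul_zero, sub_zero, add_zero] at h
  refine h.congr fun Y => ?_
  rw [smearedEnergySub]
  ring

end

/-! ### Point charges in a neutralizing background -/

/-- The sum of unit point charges at the points of `Λ`. -/
noncomputable def pointMeasure (Λ : Finset ℝ) : Measure ℝ := ∑ p ∈ Λ, Measure.dirac p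

instance isFiniteMeasure_pointMeasure (Λ : Finset ℝ) : IsFiniteMeasure (pointMeasure Λ) := by
  unfold pointMeasure
  infer_instance

lemma integral_pointMeasure {E : Type*} [NormedAddCommGroup E] [NormedSpace ℝ E] [CompleteSpace E]
    (Λ : Finset ℝ) (f : ℝ → E) : ∫ t, f t ∂pointMeasure Λ = ∑ p ∈ Λ, f p := by
  rw [pointMeasure, integral_finsetSum_measure fun p _ => integrable_dirac (by simp)]
  simp

lemma pointMeasure_real_univ (Λ : Finset ℝ) : (pointMeasure Λ).real Set.univ = Λ.card := by
  simpa using integral_pointMeasure Λ (fun _ => (1 : ℝ))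

lemma ae_pointMeasure {Λ : Finset ℝ} {P : ℝ → Prop} (h : ∀ p ∈ Λ, P p) :
    ∀ᵐ t ∂pointMeasure Λ, P t := by
  rw [ae_iff, pointMeasure, Measure.finsetSum_apply]
  exact Finset.sum_eq_zero fun p hp => by simp [Measure.dirac_apply, h p hp]

lemma mutualEnergy_pointMeasure {Λ : Finset ℝ} {μ : Measure ℝ} [IsFiniteMeasure μ]
    (h : HasMutualEnergy (pointMeasure Λ) μ) :
    mutualEnergy (pointMeasure Λ) μ = ∑ p ∈ Λ, logPotential μ p := by
  rw [mutualEnergy_eq_integral_logPotential h, integral_pointMeasure]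

section

variable {Λ : Finset ℝ} {L : ℝ} (hΛ : ∀ p ∈ Λ, |p| ≤ L)
include hΛ

lemma smearedEnergy_pointMeasure {ε : ℝ} (hε : 0 < ε) :
    smearedEnergy ε (pointMeasure Λ) (pointMeasure Λ) =
      ∑ p ∈ Λ, ∑ q ∈ Λ.erase p, Real.log ((p - q) ^ 2 + 4 * ε ^ 2) +
        Λ.card * Real.log (4 * ε ^ 2) := by
  rw [smearedEnergy, integral_prod _ (integrable_log_sub_sq_add
    (ae_prod_abs_sub_le (ae_pointMeasure hΛ) (ae_pointMeasure hΛ)) hε)]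
  simp only [integral_pointMeasure]
  rw [← nsmul_eq_mul, ← Finset.sum_const, ← Finset.sum_add_distrib]
  refine Finset.sum_congr rfl fun p hp => ?_
  rw [← Finset.add_sum_erase _ _ hp, add_comm]
  simp

lemma tendsto_smearedEnergy_pointMeasure :
    Tendsto (fun δ => smearedEnergy δ (pointMeasure Λ) (pointMeasure Λ) -
      Λ.card * Real.log (4 * δ ^ 2)) (𝓝[>] 0)
      (𝓝 (2 * ∑ p ∈ Λ, ∑ q ∈ Λ.erase p, Real.log |p - q|)) := by
  simp only [Finset.mul_sum]
  refine (tendsto_finsetSum Λ fun p _ => tendsto_finsetSum (Λ.erase p) fun q hq =>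
    tendsto_log_sq_add_four_mul_sq (sub_ne_zero.2 (Finset.ne_of_mem_erase hq).symm)).congr' ?_
  filter_upwards [self_mem_nhdsWithin] with δ hδ
  rw [smearedEnergy_pointMeasure hΛ hδ, add_sub_cancel_right]

variable {M : Measure ℝ} [IsFiniteMeasure M] {C : NNReal} (hM : M ≤ C • volume)
  (hML : ∀ᵐ t ∂M, |t| ≤ L)
include hM hML

lemma tendsto_smearedEnergySub_pointMeasure :
    Tendsto (fun δ => smearedEnergySub δ (pointMeasure Λ) M - Λ.card * Real.log (4 * δ ^ 2))
      (𝓝[>] 0) (𝓝 (2 * (∑ p ∈ Λ, ∑ q ∈ Λ.erase p, Real.log |p - q| +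
        2 * ∑ p ∈ Λ, logPotential M p - mutualEnergy M M))) := by
  have hΛL : ∀ᵐ t ∂pointMeasure Λ, |t| ≤ L := ae_pointMeasure hΛ
  have hΛM : HasMutualEnergy (pointMeasure Λ) M := hasMutualEnergy_of_le_smul_volume hM hML hΛL
  have h := ((tendsto_smearedEnergy_pointMeasure hΛ).sub
    ((tendsto_smearedEnergy_zero (ae_prod_abs_sub_le hΛL hML) hΛM).const_mul 2)).add
    (tendsto_smearedEnergy_zero (ae_prod_abs_sub_le hML hML)
      (hasMutualEnergy_of_le_smul_volume hM hML hML))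
  rw [mutualEnergy_pointMeasure hΛM] at h
  convert h using 2
  · rw [smearedEnergySub]
    ring
  · ring

/-- With the cutoffs `δ < |Im z| < δ⁻¹` tied together, neutrality removes the contribution of the
outer cutoff; the inner one contributes the self-energy `log (4 δ²)` of each charge. -/
lemma tendsto_integral_strip (hneutral : M.real Set.univ = Λ.card) :
    Tendsto (fun δ : ℝ => (∫ z in strip δ δ⁻¹,
        ‖cauchyTransform (pointMeasure Λ) z - cauchyTransform M z‖ ^ 2) +
          2 * Real.pi * Λ.card * Real.log δ) (𝓝[>] 0)
      (𝓝 (2 * Real.pi * (-∑ p ∈ Λ, ∑ q ∈ Λ.erase p, Real.log |p - q| -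
        2 * ∑ p ∈ Λ, logPotential M p + mutualEnergy M M - Λ.card * Real.log 2))) := by
  have hΛL : ∀ᵐ t ∂pointMeasure Λ, |t| ≤ L := ae_pointMeasure hΛ
  have houter := (tendsto_smearedEnergySub_atTop hΛL hML
    (by rw [pointMeasure_real_univ, hneutral])).comp tendsto_inv_nhdsGT_zero
  have hlim := ((houter.sub (tendsto_smearedEnergySub_pointMeasure hΛ hM hML)).const_mul
    Real.pi).sub_const (Real.pi * Λ.card * Real.log 4)
  have hlog4 : Real.log 4 = 2 * Real.log 2 := by
    rw [show (4 : ℝ) = 2 ^ 2 by norm_num, Real.log_pow, Nat.cast_ofNat]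
  have hval : Real.pi * (0 - 2 * (∑ p ∈ Λ, ∑ q ∈ Λ.erase p, Real.log |p - q| +
        2 * ∑ p ∈ Λ, logPotential M p - mutualEnergy M M)) - Real.pi * Λ.card * Real.log 4 =
      2 * Real.pi * (-∑ p ∈ Λ, ∑ q ∈ Λ.erase p, Real.log |p - q| -
        2 * ∑ p ∈ Λ, logPotential M p + mutualEnergy M M - Λ.card * Real.log 2) := by
    rw [hlog4]
    ring
  refine (hval ▸ hlim).congr' ?_
  filter_upwards [Ioo_mem_nhdsGT one_pos] with δ hδ
  have hle : δ ≤ δ⁻¹ := hδ.2.le.trans ((one_le_inv₀ hδ.1).2 hδ.2.le)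
  rw [integral_strip_norm_cauchyTransform_sub_sq hΛL hML hδ.1 hle,
    Real.log_mul four_ne_zero (pow_ne_zero 2 hδ.1.ne'), Real.log_pow]
  simp only [Function.comp_apply, Nat.cast_ofNat]
  ring

end

/-! ### The inverse square kernel of a disc -/

/-- The kernel `‖z - p‖⁻²` cut off outside the disc of radius `R` about `p`: the energy density of
a unit charge at `p` near that charge. -/
noncomputable def discKernel (R p : ℝ) : ℂ → ℝ :=
  (Metric.ball (p : ℂ) R).indicator fun z => (‖z - p‖ ^ 2)⁻¹

lemma measurable_discKernel (R p : ℝ) : Measurable (discKernel R p) :=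
  Measurable.indicator (by fun_prop) Metric.isOpen_ball.measurableSet

lemma discKernel_nonneg (R p : ℝ) (z : ℂ) : 0 ≤ discKernel R p z :=
  Set.indicator_nonneg (fun _ _ => by positivity) _

lemma discKernel_of_lt {R p : ℝ} {z : ℂ} (h : ‖z - p‖ < R) : discKernel R p z = (‖z - p‖ ^ 2)⁻¹ :=
  Set.indicator_of_mem (mem_ball_iff_norm.2 h) _

lemma discKernel_of_le {R p : ℝ} {z : ℂ} (h : R ≤ ‖z - p‖) : discKernel R p z = 0 :=
  Set.indicator_of_notMem (fun h' => (mem_ball_iff_norm.1 h').not_ge h) _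

lemma integrableOn_discKernel {R p η : ℝ} (hη : 0 < η) {S : Set ℂ} (hS : MeasurableSet S)
    (h : ∀ z ∈ S, η ≤ ‖z - p‖) : IntegrableOn (discKernel R p) S := by
  have hconst : Integrable ((Metric.ball (p : ℂ) R).indicator fun _ => (η ^ 2)⁻¹) :=
    (integrable_indicator_iff Metric.isOpen_ball.measurableSet).2
      (integrableOn_const measure_ball_lt_top.ne)
  refine hconst.integrableOn.mono' (measurable_discKernel R p).aestronglyMeasurable ?_
  filter_upwards [ae_restrict_mem hS] with z hz
  rw [Real.norm_of_nonneg (discKernel_nonneg _ _ _), discKernel]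
  refine Set.indicator_le_indicator ?_
  have := h z hz
  gcongr

/-- The points of `S`, in polar coordinates `(r, θ)` about `p` and at distance less than `R`. -/
def polarSector (R p : ℝ) (S : Set ℂ) : Set (ℝ × ℝ) :=
  {q | q.1 < R ∧ Complex.polarCoord.symm q + p ∈ S}

lemma measurableSet_polarSector (R p : ℝ) {S : Set ℂ} (hS : MeasurableSet S) :
    MeasurableSet (polarSector R p S) := by
  have hcont : Continuous fun q : ℝ × ℝ => Complex.polarCoord.symm q + (p : ℂ) := by
    simp only [Complex.polarCoord_symm_apply]
    fun_prop
  exact (measurableSet_lt measurable_fst measurable_const).inter (hcont.measurable hS)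

lemma smul_indicator_discKernel_polarCoord {R p : ℝ} {S : Set ℂ} {q : ℝ × ℝ} (hq : 0 < q.1) :
    q.1 • S.indicator (discKernel R p) (Complex.polarCoord.symm q + p) =
      (polarSector R p S).indicator (fun q => q.1⁻¹) q := by
  have hnorm : ‖Complex.polarCoord.symm q + p - p‖ = q.1 := by
    rw [add_sub_cancel_right, Complex.norm_polarCoord_symm, abs_of_pos hq]
  by_cases hS : Complex.polarCoord.symm q + p ∈ S
  · rw [Set.indicator_of_mem hS]
    rcases lt_or_ge q.1 R with hR | hR
    · rw [discKernel_of_lt (hnorm ▸ hR), hnorm,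
        Set.indicator_of_mem (show q ∈ polarSector R p S from ⟨hR, hS⟩), smul_eq_mul]
      field_simp
    · rw [discKernel_of_le (hnorm ▸ hR), Set.indicator_of_notMem fun h => hR.not_gt h.1, smul_zero]
  · rw [Set.indicator_of_notMem hS, Set.indicator_of_notMem fun h => hS h.2, smul_zero]

section

variable {R p η : ℝ} {S : Set ℂ} (hη : 0 < η) (hS : MeasurableSet S) (h : ∀ z ∈ S, η ≤ ‖z - p‖)
include hη hS h

lemma integrable_indicator_polarSector :
    Integrable ((polarSector R p S).indicator fun q => q.1⁻¹)
      ((volume.restrict (Set.Ioi 0)).prod (volume.restrict (Set.Ioo (-Real.pi) Real.pi))) := by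
  have hconst : Integrable (fun q : ℝ × ℝ => (Set.Iio R).indicator (fun _ => η⁻¹) q.1 * 1)
      ((volume.restrict (Set.Ioi 0)).prod (volume.restrict (Set.Ioo (-Real.pi) Real.pi))) := by
    refine Integrable.mul_prod ?_ (integrable_const (1 : ℝ))
    rw [integrable_indicator_iff measurableSet_Iio, IntegrableOn,
      Measure.restrict_restrict measurableSet_Iio]
    exact integrableOn_const (by simp [Set.Iio_inter_Ioi])
  refine hconst.mono' (Measurable.indicator (by fun_prop)
    (measurableSet_polarSector R p hS)).aestronglyMeasurable ?_
  filter_upwards [Measure.quasiMeasurePreserving_fst.ae (ae_restrict_mem measurableSet_Ioi)]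
    with q hq
  have hq : 0 < q.1 := hq
  by_cases hmem : q ∈ polarSector R p S
  · have hηq := h _ hmem.2
    rw [add_sub_cancel_right, Complex.norm_polarCoord_symm, abs_of_pos hq] at hηq
    rw [Set.indicator_of_mem hmem, Set.indicator_of_mem (Set.mem_Iio.2 hmem.1), mul_one,
      Real.norm_of_nonneg (by positivity)]
    gcongr
  · rw [Set.indicator_of_notMem hmem, norm_zero, mul_one]
    exact Set.indicator_nonneg (fun _ _ => by positivity) _

lemma setIntegral_discKernel_eq_polar :
    ∫ z in S, discKernel R p z = ∫ θ in Set.Ioo (-Real.pi) Real.pi, ∫ r in Set.Ioi (0 : ℝ),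
      (polarSector R p S).indicator (fun q => q.1⁻¹) (r, θ) := by
  rw [← integral_prod_symm _ (integrable_indicator_polarSector hη hS h), Measure.prod_restrict,
    ← Measure.volume_eq_prod, ← Complex.polarCoord_target, ← integral_indicator hS,
    ← integral_add_right_eq_self _ (p : ℂ), ← Complex.integral_comp_polarCoord_symm]
  exact setIntegral_congr_fun Complex.polarCoord.open_target.measurableSet
    fun q hq => smul_indicator_discKernel_polarCoord hq.1

end

lemma integral_indicator_Ioo_inv {a b : ℝ} (ha : 0 < a) (hab : a ≤ b) :
    ∫ r in Set.Ioi (0 : ℝ), (Set.Ioo a b).indicator (fun r => r⁻¹) r = Real.log (b / a) := by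
  rw [setIntegral_indicator measurableSet_Ioo,
    Set.inter_eq_right.2 fun y (hy : y ∈ Set.Ioo a b) => Set.mem_Ioi.2 (ha.trans hy.1),
    ← integral_Ioc_eq_integral_Ioo, ← intervalIntegral.integral_of_le hab,
    integral_inv_of_pos ha (ha.trans_le hab)]

lemma setIntegral_compl_ball_discKernel {R p η : ℝ} (hη : 0 < η) (hR : η ≤ R) :
    ∫ z in (Metric.ball (p : ℂ) η)ᶜ, discKernel R p z = 2 * Real.pi * Real.log (R / η) := by
  have hsector (θ : ℝ) : ∫ r in Set.Ioi (0 : ℝ),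
      (polarSector R p (Metric.ball (p : ℂ) η)ᶜ).indicator (fun q => q.1⁻¹) (r, θ) =
        Real.log (R / η) := by
    rw [← integral_indicator_Ioo_inv hη hR, integral_congr_ae (ae_restrict_of_ae
      (indicator_ae_eq_of_ae_eq_set (f := fun r : ℝ => r⁻¹) (Ioo_ae_eq_Ico (a := η) (b := R))))]
    refine setIntegral_congr_fun measurableSet_Ioi fun r hr => ?_
    have hr : 0 < r := hr
    simp [Set.indicator_apply, polarSector, abs_of_pos hr, and_comm]
  rw [setIntegral_discKernel_eq_polar hη Metric.isOpen_ball.measurableSet.compl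
    fun z hz => by simpa [dist_eq_norm] using hz]
  simp only [hsector, setIntegral_const, Real.volume_real_Ioo, smul_eq_mul]
  rw [max_eq_left (by linarith [Real.pi_pos])]
  ring

lemma integrableOn_Ioo_log_abs_sin :
    IntegrableOn (fun θ => Real.log |Real.sin θ|) (Set.Ioo (-Real.pi) Real.pi) := by
  simp only [Real.log_abs]
  exact ((intervalIntegrable_iff_integrableOn_Ioc_of_le (by linarith [Real.pi_pos])).1
    intervalIntegrable_log_sin).mono_set Set.Ioo_subset_Ioc_self

lemma integral_Ioo_log_abs_sin :
    ∫ θ in Set.Ioo (-Real.pi) Real.pi, Real.log |Real.sin θ| = -(2 * Real.pi * Real.log 2) := by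
  have hneg : ∫ θ in -Real.pi..0, Real.log (Real.sin θ) = ∫ θ in 0..Real.pi,
      Real.log (Real.sin θ) := by
    have := intervalIntegral.integral_comp_neg (a := 0) (b := Real.pi)
      fun θ => Real.log (Real.sin θ)
    simpa only [Real.sin_neg, Real.log_neg_eq_log, neg_zero] using this.symm
  have hint (a b : ℝ) : IntervalIntegrable (fun θ => Real.log (Real.sin θ)) volume a b :=
    intervalIntegrable_log_sin
  simp only [Real.log_abs]
  rw [← integral_Ioc_eq_integral_Ioo,
    ← intervalIntegral.integral_of_le (by linarith [Real.pi_pos]),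
    ← intervalIntegral.integral_add_adjacent_intervals (b := 0) (hint _ _) (hint _ _), hneg,
    integral_log_sin_zero_pi]
  ring

lemma tendsto_integral_max_log_sin :
    Tendsto (fun ε : ℝ => ∫ θ in Set.Ioo (-Real.pi) Real.pi,
      max (Real.log ε) (Real.log |Real.sin θ|)) (𝓝[>] 0) (𝓝 (-(2 * Real.pi * Real.log 2))) := by
  rw [← integral_Ioo_log_abs_sin]
  refine tendsto_integral_filter_of_dominated_convergence
    (fun θ : ℝ => ‖Real.log (abs (Real.sin θ))‖) (Eventually.of_forall fun ε => ?_) ?_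
    integrableOn_Ioo_log_abs_sin.norm (ae_of_all _ fun θ => ?_)
  · exact (measurable_const.max
      (Real.measurable_log.comp Real.measurable_sin.abs)).aestronglyMeasurable
  · filter_upwards [Ioo_mem_nhdsGT one_pos] with ε hε
    refine ae_of_all _ fun θ => ?_
    have hε : Real.log ε ≤ 0 := Real.log_nonpos hε.1.le hε.2.le
    have hsin : Real.log |Real.sin θ| ≤ 0 :=
      Real.log_nonpos (abs_nonneg _) (Real.abs_sin_le_one θ)
    rw [Real.norm_eq_abs, Real.norm_eq_abs, abs_of_nonpos (max_le hε hsin), abs_of_nonpos hsin]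
    exact neg_le_neg (le_max_right _ _)
  · refine tendsto_const_nhds.congr' ?_
    filter_upwards [Real.tendsto_log_nhdsGT_zero.eventually_le_atBot (Real.log |Real.sin θ|)]
      with ε hε
    exact (max_eq_right hε).symm

lemma integral_indicator_Ioo_div_inv {s δ R : ℝ} (hs : 0 < s) (hδ : 0 < δ) (hR : 0 < R) :
    ∫ r in Set.Ioi (0 : ℝ), (Set.Ioo (δ / s) R).indicator (fun r => r⁻¹) r =
      max (Real.log (δ / R)) (Real.log s) - Real.log (δ / R) := by
  rcases le_total (δ / R) s with h | h
  · rw [integral_indicator_Ioo_inv (by positivity) ((div_le_comm₀ hR hs).1 h),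
      max_eq_right (Real.log_le_log (by positivity) h),
      ← Real.log_div (by positivity) (by positivity)]
    congr 1
    field_simp
  · rw [Set.Ioo_eq_empty (not_lt.2 ((le_div_comm₀ hs hR).1 h)), Set.indicator_empty,
      max_eq_left (Real.log_le_log hs h)]
    simp

lemma integral_indicator_polarSector_strip {R p δ Y θ : ℝ} (hδ : 0 < δ) (hR : 0 < R) (hY : R ≤ Y)
    (hθ : Real.sin θ ≠ 0) :
    ∫ r in Set.Ioi (0 : ℝ), (polarSector R p (strip δ Y)).indicator (fun q => q.1⁻¹) (r, θ) =
      max (Real.log (δ / R)) (Real.log |Real.sin θ|) - Real.log (δ / R) := by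
  have hsin : 0 < |Real.sin θ| := abs_pos.2 hθ
  rw [← integral_indicator_Ioo_div_inv hsin hδ hR]
  refine setIntegral_congr_fun measurableSet_Ioi fun r hr => ?_
  have him : |(Complex.polarCoord.symm (r, θ) + (p : ℂ)).im| = r * |Real.sin θ| := by
    rw [Complex.polarCoord_symm_apply]
    simp [-Complex.ofReal_cos, -Complex.ofReal_sin, abs_mul, abs_of_pos (Set.mem_Ioi.1 hr)]
  have hlt (hrR : r < R) : r * |Real.sin θ| < Y :=
    (mul_le_of_le_one_right (Set.mem_Ioi.1 hr).le (Real.abs_sin_le_one θ)).trans_lt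
      (hrR.trans_le hY)
  have hmem : (r, θ) ∈ polarSector R p (strip δ Y) ↔ r ∈ Set.Ioo (δ / |Real.sin θ|) R := by
    change r < R ∧ |(Complex.polarCoord.symm (r, θ) + (p : ℂ)).im| ∈ Set.Ioo δ Y ↔ _
    rw [him, Set.mem_Ioo, Set.mem_Ioo, div_lt_iff₀ hsin]
    tauto
  by_cases hr' : r ∈ Set.Ioo (δ / |Real.sin θ|) R
  · rw [Set.indicator_of_mem (hmem.2 hr'), Set.indicator_of_mem hr']
  · rw [Set.indicator_of_notMem (mt hmem.1 hr'), Set.indicator_of_notMem hr']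

lemma ae_restrict_Ioo_sin_ne_zero :
    ∀ᵐ θ ∂volume.restrict (Set.Ioo (-Real.pi) Real.pi), Real.sin θ ≠ 0 := by
  filter_upwards [ae_restrict_mem measurableSet_Ioo,
    ae_restrict_of_ae (Measure.ae_ne volume (0 : ℝ))] with θ hθ hne hsin
  exact hne ((Real.sin_eq_zero_iff_of_lt_of_lt hθ.1 hθ.2).1 hsin)

lemma setIntegral_strip_discKernel {R p δ Y : ℝ} (hδ : 0 < δ) (hR : 0 < R) (hY : R ≤ Y) :
    ∫ z in strip δ Y, discKernel R p z =
      (∫ θ in Set.Ioo (-Real.pi) Real.pi, max (Real.log (δ / R)) (Real.log |Real.sin θ|)) -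
        2 * Real.pi * Real.log (δ / R) := by
  have hmax : IntegrableOn (fun θ => max (Real.log (δ / R)) (Real.log |Real.sin θ|))
      (Set.Ioo (-Real.pi) Real.pi) :=
    Integrable.sup (integrable_const _) integrableOn_Ioo_log_abs_sin
  rw [setIntegral_discKernel_eq_polar hδ (measurableSet_strip δ Y)
      fun z hz => hz.1.le.trans (abs_im_le_norm_sub_ofReal z p),
    integral_congr_ae (ae_restrict_Ioo_sin_ne_zero.mono fun θ hθ =>
      integral_indicator_polarSector_strip hδ hR hY hθ),
    integral_sub hmax (integrable_const _), setIntegral_const, Real.volume_real_Ioo,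
    max_eq_left (by linarith [Real.pi_pos]), smul_eq_mul]
  ring

lemma tendsto_setIntegral_strip_discKernel {R : ℝ} (hR : 0 < R) (p : ℝ) :
    Tendsto (fun δ : ℝ => (∫ z in strip δ δ⁻¹, discKernel R p z) + 2 * Real.pi * Real.log δ)
      (𝓝[>] 0) (𝓝 (2 * Real.pi * (Real.log R - Real.log 2))) := by
  have hdiv : Tendsto (fun δ : ℝ => δ / R) (𝓝[>] 0) (𝓝[>] 0) := by
    refine tendsto_nhdsWithin_iff.2 ⟨?_, ?_⟩
    · simpa using (tendsto_id (x := 𝓝 (0 : ℝ))).div_const R |>.mono_left nhdsWithin_le_nhds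
    · filter_upwards [self_mem_nhdsWithin] with δ hδ
      exact div_pos hδ hR
  have hlim := (tendsto_integral_max_log_sin.comp hdiv).add_const (2 * Real.pi * Real.log R)
  rw [show -(2 * Real.pi * Real.log 2) + 2 * Real.pi * Real.log R =
    2 * Real.pi * (Real.log R - Real.log 2) by ring] at hlim
  refine hlim.congr' ?_
  filter_upwards [Ioo_mem_nhdsGT (inv_pos.2 hR)] with δ hδ
  rw [setIntegral_strip_discKernel hδ.1 hR ((le_inv_comm₀ hR hδ.1).2 hδ.2.le),
    Real.log_div hδ.1.ne' hR.ne', Function.comp_apply, Real.log_div hδ.1.ne' hR.ne']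
  ring

/-! ### Local integrability near the charges -/

lemma integrableOn_abs_sub_rpow {r : ℝ} (hr : -1 < r) (p T : ℝ) :
    IntegrableOn (fun x : ℝ => |x - p| ^ r) (Set.Icc (-T) T) := by
  refine (((measurePreserving_sub_right volume p).integrableOn_comp_preimage
    (measurableEmbedding_subRight p)).2 (integrableOn_abs_rpow hr (T + |p|))).mono_set
    fun x hx => ⟨?_, ?_⟩
  · linarith [le_abs_self p, hx.1]
  · linarith [neg_abs_le p, hx.2]

lemma locallyIntegrable_abs_rpow_mul_abs_rpow {a b : ℝ} (ha : -1 < a) (hb : -1 < b) (p : ℝ) :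
    LocallyIntegrable fun z : ℂ => |z.re - p| ^ a * |z.im| ^ b := by
  refine locallyIntegrable_iff.2 fun K hK => ?_
  obtain ⟨T, hT⟩ := hK.isBounded.subset_closedBall 0
  have hprod : IntegrableOn (fun q : ℝ × ℝ => |q.1 - p| ^ a * |q.2| ^ b)
      (Set.Icc (-T) T ×ˢ Set.Icc (-T) T) := by
    rw [IntegrableOn, Measure.volume_eq_prod, ← Measure.prod_restrict]
    exact (integrableOn_abs_sub_rpow ha p T).mul_prod (integrableOn_abs_rpow hb T)
  refine ((Complex.volume_preserving_equiv_real_prod.integrableOn_comp_preimage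
    Complex.measurableEquivRealProd.measurableEmbedding).2 hprod).mono_set fun z hz => ?_
  have hz : ‖z‖ ≤ T := by simpa using hT hz
  exact ⟨abs_le.1 ((Complex.abs_re_le_norm z).trans hz),
    abs_le.1 ((Complex.abs_im_le_norm z).trans hz)⟩

lemma ae_re_ne (p : ℝ) : ∀ᵐ z : ℂ, z.re ≠ p :=
  Complex.volume_preserving_equiv_real_prod.quasiMeasurePreserving.ae
    (Measure.quasiMeasurePreserving_fst.ae (Measure.ae_ne volume p))

lemma ae_im_ne_zero : ∀ᵐ z : ℂ, z.im ≠ 0 :=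
  Complex.volume_preserving_equiv_real_prod.quasiMeasurePreserving.ae
    (Measure.quasiMeasurePreserving_snd.ae (Measure.ae_ne volume 0))

lemma inv_norm_sub_le_rpow_mul_rpow {z : ℂ} {t a b : ℝ} (ha : a ≤ 0) (hb : b ≤ 0)
    (hab : a + b = -1) (hre : z.re ≠ t) (him : z.im ≠ 0) :
    ‖z - t‖⁻¹ ≤ |z.re - t| ^ a * |z.im| ^ b := by
  have hx : 0 < |z.re - t| := abs_pos.2 (sub_ne_zero.2 hre)
  have hy : 0 < |z.im| := abs_pos.2 him
  have hxz : |z.re - t| ≤ ‖z - t‖ := by simpa using Complex.abs_re_le_norm (z - t)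
  rw [← Real.rpow_neg_one, ← hab, Real.rpow_add (hx.trans_le hxz)]
  exact mul_le_mul (Real.rpow_le_rpow_of_nonpos hx hxz ha)
    (Real.rpow_le_rpow_of_nonpos hy (abs_im_le_norm_sub_ofReal z t) hb) (by positivity)
    (by positivity)

lemma locallyIntegrable_inv_norm_sub (p : ℝ) : LocallyIntegrable fun z : ℂ => ‖z - p‖⁻¹ := by
  refine (locallyIntegrable_abs_rpow_mul_abs_rpow (a := -(1 / 2)) (b := -(1 / 2)) (by norm_num)
    (by norm_num) p).mono (by fun_prop) ?_
  filter_upwards [ae_re_ne p, ae_im_ne_zero] with z hre him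
  rw [Real.norm_of_nonneg (by positivity), Real.norm_of_nonneg (by positivity)]
  exact inv_norm_sub_le_rpow_mul_rpow (by norm_num) (by norm_num) (by norm_num) hre him

lemma inv_mul_inv_le {x y d : ℝ} (hx : 0 < x) (hy : 0 < y) (hd : 0 < d) (h : d ≤ x + y) :
    x⁻¹ * y⁻¹ ≤ d⁻¹ * (x⁻¹ + y⁻¹) := by
  rw [inv_add_inv hx.ne' hy.ne', inv_mul_eq_div d, le_div_iff₀ hd, ← mul_inv, inv_mul_eq_div]
  gcongr

lemma abs_sub_le_norm_sub_add_norm_sub (p q : ℝ) (z : ℂ) : |p - q| ≤ ‖z - p‖ + ‖z - q‖ := by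
  simpa [dist_eq_norm, ← Complex.ofReal_sub, norm_sub_rev (p : ℂ) z]
    using dist_triangle (p : ℂ) z q

lemma locallyIntegrable_inner_inv_sub_inv_sub {p q : ℝ} (hpq : p ≠ q) :
    LocallyIntegrable fun z : ℂ => inner ℝ (z - p)⁻¹ (z - q)⁻¹ := by
  refine (((locallyIntegrable_inv_norm_sub p).add (locallyIntegrable_inv_norm_sub q)).smul
    |p - q|⁻¹).mono (by fun_prop) ?_
  filter_upwards [ae_im_ne_zero] with z hz
  have hpos (t : ℝ) : 0 < ‖z - t‖ := (abs_pos.2 hz).trans_le (abs_im_le_norm_sub_ofReal z t)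
  refine (abs_real_inner_le_norm _ _).trans ?_
  simp only [norm_inv]
  exact (inv_mul_inv_le (hpos p) (hpos q) (abs_pos.2 (sub_ne_zero.2 hpq))
    (abs_sub_le_norm_sub_add_norm_sub p q z)).trans (le_abs_self _)

section

variable {M : Measure ℝ} [IsFiniteMeasure M] {C : NNReal} (hM : M ≤ C • volume)
include hM

lemma exists_norm_cauchyTransform_le :
    ∃ K : ℝ, 0 ≤ K ∧ ∀ z : ℂ, z.im ≠ 0 →
      ‖cauchyTransform M z‖ ≤ K * |z.im| ^ (-(1 / 4) : ℝ) := by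
  obtain ⟨K, hK0, hK⟩ := exists_integral_abs_sub_rpow_le hM (r := -(3 / 4)) (by norm_num)
    (by norm_num)
  refine ⟨K, hK0, fun z hz => ?_⟩
  calc ‖cauchyTransform M z‖ ≤ ∫ t : ℝ, ‖(z - t)⁻¹‖ ∂M := norm_integral_le_integral_norm _
    _ ≤ ∫ t, |z.re - t| ^ (-(3 / 4) : ℝ) * |z.im| ^ (-(1 / 4) : ℝ) ∂M := by
        refine integral_mono_ae (integrable_inv_sub_ofReal M hz).norm
          ((hK z.re).1.mul_const _) ?_
        filter_upwards [ae_ne_of_le_smul_volume hM z.re] with t ht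
        rw [norm_inv]
        exact inv_norm_sub_le_rpow_mul_rpow (by norm_num) (by norm_num) (by norm_num) ht hz
    _ ≤ K * |z.im| ^ (-(1 / 4) : ℝ) := by
        rw [integral_mul_const]
        gcongr
        exact (hK z.re).2

lemma locallyIntegrable_inner_inv_sub_cauchyTransform (p : ℝ) :
    LocallyIntegrable fun z : ℂ => inner ℝ (z - p)⁻¹ (cauchyTransform M z) := by
  obtain ⟨K, hK0, hK⟩ := exists_norm_cauchyTransform_le hM
  refine ((locallyIntegrable_abs_rpow_mul_abs_rpow (a := -(1 / 2)) (b := -(3 / 4)) (by norm_num)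
    (by norm_num) p).smul K).mono ?_ ?_
  · exact ((by fun_prop : Measurable fun z : ℂ => (z - p)⁻¹).inner
      (stronglyMeasurable_cauchyTransform M).measurable).aestronglyMeasurable
  · filter_upwards [ae_re_ne p, ae_im_ne_zero] with z hre him
    refine (abs_real_inner_le_norm _ _).trans ?_
    rw [Pi.smul_apply, Real.norm_of_nonneg (by positivity), norm_inv]
    calc ‖z - p‖⁻¹ * ‖cauchyTransform M z‖
        ≤ (|z.re - p| ^ (-(1 / 2) : ℝ) * |z.im| ^ (-(1 / 2) : ℝ)) *
          (K * |z.im| ^ (-(1 / 4) : ℝ)) :=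
          mul_le_mul (inv_norm_sub_le_rpow_mul_rpow (by norm_num) (by norm_num) (by norm_num)
            hre him) (hK z him) (norm_nonneg _) (by positivity)
      _ = K • (|z.re - p| ^ (-(1 / 2) : ℝ) * |z.im| ^ (-(3 / 4) : ℝ)) := by
          rw [show (-(3 / 4) : ℝ) = -(1 / 2) + -(1 / 4) by norm_num, Real.rpow_add (abs_pos.2 him),
            smul_eq_mul]
          ring

lemma locallyIntegrable_sq_norm_cauchyTransform :
    LocallyIntegrable fun z : ℂ => ‖cauchyTransform M z‖ ^ 2 := by
  obtain ⟨K, -, hK⟩ := exists_norm_cauchyTransform_le hM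
  refine ((locallyIntegrable_abs_rpow_mul_abs_rpow (a := 0) (b := -(1 / 2)) (by norm_num)
    (by norm_num) 0).smul (K ^ 2)).mono
    ((stronglyMeasurable_cauchyTransform M).measurable.norm.pow_const 2).aestronglyMeasurable ?_
  filter_upwards [ae_im_ne_zero] with z hz
  rw [Pi.smul_apply, Real.norm_of_nonneg (by positivity), Real.norm_of_nonneg (by positivity),
    Real.rpow_zero, one_mul]
  calc ‖cauchyTransform M z‖ ^ 2 ≤ (K * |z.im| ^ (-(1 / 4) : ℝ)) ^ 2 := by
        have := hK z hz
        gcongr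
    _ = K ^ 2 • |z.im| ^ (-(1 / 2) : ℝ) := by
        rw [mul_pow, ← Real.rpow_mul_natCast (abs_nonneg _), smul_eq_mul]
        norm_num

end

/-! ### The regularized energy density -/

/-- The electric field, as a complex number, of charges `k p` at the points `p ∈ Λ` and of a
negative background `M`. -/
noncomputable def chargeField (Λ : Finset ℝ) (k : ℝ → ℝ) (M : Measure ℝ) (z : ℂ) : ℂ :=
  ∑ p ∈ Λ, k p • (z - p)⁻¹ - cauchyTransform M z

/-- The energy density `‖chargeField Λ k M‖ ^ 2` of which the singular part at each charge, cut off
at distance `R`, is removed. -/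
noncomputable def regularDensity (R : ℝ) (Λ : Finset ℝ) (k : ℝ → ℝ) (M : Measure ℝ) (z : ℂ) : ℝ :=
  ‖chargeField Λ k M z‖ ^ 2 - ∑ p ∈ Λ, k p ^ 2 * discKernel R p z

lemma norm_sum_sub_sq {ι F : Type*} [NormedAddCommGroup F] [InnerProductSpace ℝ F]
    [DecidableEq ι] (s : Finset ι) (x : ι → F) (y : F) :
    ‖∑ i ∈ s, x i - y‖ ^ 2 = ∑ i ∈ s, ‖x i‖ ^ 2 + ∑ i ∈ s, ∑ j ∈ s.erase i, inner ℝ (x i) (x j) -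
      2 * ∑ i ∈ s, inner ℝ (x i) y + ‖y‖ ^ 2 := by
  have hsum : ‖∑ i ∈ s, x i‖ ^ 2 =
      ∑ i ∈ s, ‖x i‖ ^ 2 + ∑ i ∈ s, ∑ j ∈ s.erase i, inner ℝ (x i) (x j) := by
    rw [← real_inner_self_eq_norm_sq, sum_inner, ← Finset.sum_add_distrib]
    refine Finset.sum_congr rfl fun i hi => ?_
    rw [inner_sum, ← Finset.add_sum_erase _ _ hi, real_inner_self_eq_norm_sq]
  rw [norm_sub_sq_real, hsum, sum_inner]

lemma regularDensity_eq (R : ℝ) (Λ : Finset ℝ) (k : ℝ → ℝ) (M : Measure ℝ) (z : ℂ) :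
    regularDensity R Λ k M z =
      ∑ p ∈ Λ, k p ^ 2 * (‖(z - (p : ℂ))⁻¹‖ ^ 2 - discKernel R p z) +
      ∑ p ∈ Λ, ∑ q ∈ Λ.erase p, k q * (k p * inner ℝ (z - p)⁻¹ (z - q)⁻¹) -
      2 * ∑ p ∈ Λ, k p * inner ℝ (z - p)⁻¹ (cauchyTransform M z) +
      ‖cauchyTransform M z‖ ^ 2 := by
  rw [regularDensity, chargeField, norm_sum_sub_sq]
  simp only [norm_smul, mul_pow, Real.norm_eq_abs, sq_abs, real_inner_smul_left,
    real_inner_smul_right, mul_sub, Finset.sum_sub_distrib]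
  ring

lemma locallyIntegrable_sq_norm_inv_sub_discKernel {R : ℝ} (hR : 0 < R) (p : ℝ) :
    LocallyIntegrable fun z : ℂ => ‖(z - (p : ℂ))⁻¹‖ ^ 2 - discKernel R p z := by
  refine (locallyIntegrable_const (R ^ 2)⁻¹).mono
    ((by fun_prop : Measurable fun z : ℂ => ‖(z - (p : ℂ))⁻¹‖ ^ 2).sub
      (measurable_discKernel R p)).aestronglyMeasurable (ae_of_all _ fun z => ?_)
  rw [norm_inv, inv_pow, Real.norm_of_nonneg (show 0 ≤ (R ^ 2)⁻¹ by positivity)]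
  rcases lt_or_ge ‖z - p‖ R with h | h
  · rw [discKernel_of_lt h, sub_self, norm_zero]
    positivity
  · rw [discKernel_of_le h, sub_zero, Real.norm_of_nonneg (by positivity)]
    gcongr

lemma locallyIntegrable_regularDensity {M : Measure ℝ} [IsFiniteMeasure M] {C : NNReal}
    (hM : M ≤ C • volume) (Λ : Finset ℝ) (k : ℝ → ℝ) {R : ℝ} (hR : 0 < R) :
    LocallyIntegrable (regularDensity R Λ k M) := by
  rw [show regularDensity R Λ k M = _ from funext (regularDensity_eq R Λ k M)]
  refine (((locallyIntegrable_finsetSum _ fun p _ => ?_).add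
    (locallyIntegrable_finsetSum _ fun p _ => locallyIntegrable_finsetSum _ fun q hq => ?_)).sub
    ((locallyIntegrable_finsetSum _ fun p _ => ?_).smul (2 : ℝ))).add
    (locallyIntegrable_sq_norm_cauchyTransform hM)
  · exact (locallyIntegrable_sq_norm_inv_sub_discKernel hR p).smul (k p ^ 2)
  · exact ((locallyIntegrable_inner_inv_sub_inv_sub (Finset.ne_of_mem_erase hq).symm).smul
      (k p)).smul (k q)
  · exact (locallyIntegrable_inner_inv_sub_cauchyTransform hM p).smul (k p)

lemma half_norm_le_norm_sub_ofReal {z : ℂ} {t L : ℝ} (ht : |t| ≤ L) (hz : 2 * L ≤ ‖z‖) :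
    ‖z‖ / 2 ≤ ‖z - t‖ := by
  have := norm_sub_norm_le z (t : ℂ)
  rw [Complex.norm_real, Real.norm_eq_abs] at this
  linarith

lemma norm_inv_sub_inv_le {z : ℂ} {t L : ℝ} (hz0 : z ≠ 0) (ht : |t| ≤ L) (hz : 2 * L ≤ ‖z‖) :
    ‖(z - t)⁻¹ - z⁻¹‖ ≤ 2 * L / ‖z‖ ^ 2 := by
  have hpos : 0 < ‖z‖ := norm_pos_iff.2 hz0
  have hhalf := half_norm_le_norm_sub_ofReal ht hz
  have hzt : z - t ≠ 0 := norm_pos_iff.1 (by linarith)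
  rw [inv_sub_inv hzt hz0, sub_sub_cancel, norm_div, norm_mul, Complex.norm_real, Real.norm_eq_abs,
    div_le_div_iff₀ (mul_pos (by linarith) hpos) (by positivity)]
  calc |t| * ‖z‖ ^ 2 ≤ L * ‖z‖ ^ 2 := by gcongr
    _ = 2 * L * (‖z‖ / 2 * ‖z‖) := by ring
    _ ≤ 2 * L * (‖z - t‖ * ‖z‖) := by
        have := (abs_nonneg t).trans ht
        gcongr

section

variable {M : Measure ℝ} [IsFiniteMeasure M] {L : ℝ} (hML : ∀ᵐ t ∂M, |t| ≤ L)
  {Λ : Finset ℝ} {k : ℝ → ℝ} (hk : ∀ p, 0 ≤ k p) (hΛ : ∀ p ∈ Λ, |p| ≤ L)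
  (hneutral : M.real Set.univ = ∑ p ∈ Λ, k p)
include hML hneutral

/-- Neutrality cancels the leading `‖z‖⁻¹` term of the field at infinity. -/
lemma chargeField_eq_sum_sub_integral {z : ℂ} (hz0 : z ≠ 0) (hz : 2 * L ≤ ‖z‖) :
    chargeField Λ k M z =
      ∑ p ∈ Λ, k p • ((z - p)⁻¹ - z⁻¹) - ∫ t : ℝ, ((z - t)⁻¹ - z⁻¹) ∂M := by
  have hint : Integrable (fun t : ℝ => (z - (t : ℂ))⁻¹) M := by
    refine Integrable.of_bound (by fun_prop) (‖z‖ / 2)⁻¹ (hML.mono fun t ht => ?_)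
    rw [norm_inv]
    exact inv_anti₀ (half_pos (norm_pos_iff.2 hz0)) (half_norm_le_norm_sub_ofReal ht hz)
  rw [integral_sub hint (integrable_const _), integral_const, hneutral]
  simp only [smul_sub, Finset.sum_sub_distrib, ← Finset.sum_smul]
  rw [chargeField, cauchyTransform]
  abel

include hk hΛ

lemma norm_chargeField_le {z : ℂ} (hz0 : z ≠ 0) (hz : 2 * L ≤ ‖z‖) :
    ‖chargeField Λ k M z‖ ≤ 4 * L * M.real Set.univ / ‖z‖ ^ 2 := by
  have hsum : ‖∑ p ∈ Λ, k p • ((z - (p : ℂ))⁻¹ - z⁻¹)‖ ≤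
      M.real Set.univ * (2 * L / ‖z‖ ^ 2) := by
    rw [hneutral, Finset.sum_mul]
    refine norm_sum_le_of_le _ fun p hp => ?_
    rw [norm_smul, Real.norm_of_nonneg (hk p)]
    exact mul_le_mul_of_nonneg_left (norm_inv_sub_inv_le hz0 (hΛ p hp) hz) (hk p)
  have hint : ‖∫ t : ℝ, ((z - (t : ℂ))⁻¹ - z⁻¹) ∂M‖ ≤ 2 * L / ‖z‖ ^ 2 * M.real Set.univ :=
    norm_integral_le_of_norm_le_const (hML.mono fun t ht => norm_inv_sub_inv_le hz0 ht hz)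
  rw [chargeField_eq_sum_sub_integral hML hneutral hz0 hz]
  refine (norm_sub_le _ _).trans ((add_le_add hsum hint).trans (le_of_eq ?_))
  ring

lemma isBigO_regularDensity (R : ℝ) :
    regularDensity R Λ k M =O[cocompact ℂ] fun z => (1 + ‖z‖) ^ (-(4 : ℝ)) := by
  refine Asymptotics.IsBigO.of_bound ((4 * L * M.real Set.univ) ^ 2 * 16) ?_
  filter_upwards [tendsto_norm_cocompact_atTop.eventually_ge_atTop 1,
    tendsto_norm_cocompact_atTop.eventually_ge_atTop (2 * L),
    tendsto_norm_cocompact_atTop.eventually_ge_atTop (L + R)] with z hz1 hzL hzR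
  have hdisc : ∑ p ∈ Λ, k p ^ 2 * discKernel R p z = 0 := by
    refine Finset.sum_eq_zero fun p hp => ?_
    have := norm_sub_norm_le z (p : ℂ)
    rw [Complex.norm_real, Real.norm_eq_abs] at this
    rw [discKernel_of_le (by linarith [hΛ p hp]), mul_zero]
  have hpow : (‖z‖ ^ 4)⁻¹ ≤ 16 * ((1 + ‖z‖) ^ 4)⁻¹ := by
    rw [← div_eq_mul_inv, inv_eq_one_div, div_le_div_iff₀ (by positivity) (by positivity)]
    calc 1 * (1 + ‖z‖) ^ 4 ≤ 1 * (2 * ‖z‖) ^ 4 := by gcongr; linarith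
      _ = 16 * ‖z‖ ^ 4 := by ring
  rw [regularDensity, hdisc, sub_zero, Real.norm_of_nonneg (by positivity),
    Real.norm_of_nonneg (by positivity), Real.rpow_neg (by positivity),
    show (4 : ℝ) = (4 : ℕ) by norm_num, Real.rpow_natCast, Nat.cast_ofNat]
  calc ‖chargeField Λ k M z‖ ^ 2 ≤ (4 * L * M.real Set.univ / ‖z‖ ^ 2) ^ 2 := by
        have := norm_chargeField_le hML hk hΛ hneutral (norm_pos_iff.1 (by linarith)) hzL
        gcongr
    _ = (4 * L * M.real Set.univ) ^ 2 * (‖z‖ ^ 4)⁻¹ := by ring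
    _ ≤ (4 * L * M.real Set.univ) ^ 2 * (16 * ((1 + ‖z‖) ^ 4)⁻¹) := by gcongr
    _ = _ := by ring

lemma integrable_regularDensity {C : NNReal} (hM : M ≤ C • volume) {R : ℝ} (hR : 0 < R) :
    Integrable (regularDensity R Λ k M) :=
  (locallyIntegrable_regularDensity hM Λ k hR).integrable_of_isBigO_cocompact
    (isBigO_regularDensity hML hk hΛ hneutral R)
    ((integrable_one_add_norm (by
      rw [Complex.finrank_real_complex]; norm_num)).integrableAtFilter _)

end

/-! ### Renormalization by discs and by strips -/

/-- The complement of the discs of radius `η` about the points of `Λ`. -/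
def outerDomain (Λ : Finset ℝ) (η : ℝ) : Set ℂ := (⋃ p ∈ Λ, Metric.ball (p : ℂ) η)ᶜ

lemma mem_outerDomain {Λ : Finset ℝ} {η : ℝ} {z : ℂ} :
    z ∈ outerDomain Λ η ↔ ∀ p ∈ Λ, η ≤ ‖z - p‖ := by
  simp [outerDomain, dist_eq_norm]

lemma measurableSet_outerDomain (Λ : Finset ℝ) (η : ℝ) : MeasurableSet (outerDomain Λ η) :=
  (Λ.measurableSet_biUnion fun _ _ => Metric.isOpen_ball.measurableSet).compl

lemma eventually_two_mul_le_abs_sub (Λ : Finset ℝ) :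
    ∀ᶠ R in 𝓝[>] (0 : ℝ), ∀ p ∈ Λ, ∀ q ∈ Λ, p ≠ q → 2 * R ≤ |p - q| := by
  refine (Filter.eventually_all_finset Λ).2 fun p _ =>
    (Filter.eventually_all_finset Λ).2 fun q _ => ?_
  by_cases h : p = q
  · exact Eventually.of_forall fun _ hpq => absurd h hpq
  · filter_upwards [Ioo_mem_nhdsGT (half_pos (abs_pos.2 (sub_ne_zero.2 h)))] with R hR _
    linarith [hR.2]

lemma setIntegral_outerDomain_discKernel {Λ : Finset ℝ} {R η p : ℝ} (hp : p ∈ Λ)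
    (hsep : ∀ q ∈ Λ, p ≠ q → 2 * R ≤ |p - q|) (hη : 0 < η) (hR : η ≤ R) :
    ∫ z in outerDomain Λ η, discKernel R p z = 2 * Real.pi * Real.log (R / η) := by
  rw [← setIntegral_compl_ball_discKernel (p := p) hη hR]
  have hsub : outerDomain Λ η ⊆ (Metric.ball (p : ℂ) η)ᶜ := fun z hz => by
    simpa [dist_eq_norm] using mem_outerDomain.1 hz p hp
  refine (setIntegral_eq_of_subset_of_forall_sdiff_eq_zero
    Metric.isOpen_ball.measurableSet.compl hsub fun z hz => discKernel_of_le ?_).symm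
  have hzp : η ≤ ‖z - p‖ := by simpa [dist_eq_norm] using hz.1
  obtain ⟨q, hq, hzq⟩ : ∃ q ∈ Λ, ‖z - q‖ < η := by simpa [mem_outerDomain] using hz.2
  have hpq : p ≠ q := by
    rintro rfl
    exact hzq.not_ge hzp
  linarith [hsep q hq hpq, abs_sub_le_norm_sub_add_norm_sub p q z]

lemma integrableOn_outerDomain_discKernel (R : ℝ) {Λ : Finset ℝ} {η p : ℝ} (hp : p ∈ Λ)
    (hη : 0 < η) : IntegrableOn (discKernel R p) (outerDomain Λ η) :=
  integrableOn_discKernel hη (measurableSet_outerDomain Λ η) fun _ hz => mem_outerDomain.1 hz p hp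

lemma integrableOn_strip_discKernel (R p : ℝ) {δ : ℝ} (hδ : 0 < δ) (Y : ℝ) :
    IntegrableOn (discKernel R p) (strip δ Y) :=
  integrableOn_discKernel hδ (measurableSet_strip δ Y) fun z hz =>
    hz.1.le.trans (abs_im_le_norm_sub_ofReal z p)

section

variable {R : ℝ} {Λ : Finset ℝ} {k : ℝ → ℝ} {M : Measure ℝ} {S : Set ℂ}

lemma sq_norm_chargeField_eq (R : ℝ) (Λ : Finset ℝ) (k : ℝ → ℝ) (M : Measure ℝ) (z : ℂ) :
    ‖chargeField Λ k M z‖ ^ 2 =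
      regularDensity R Λ k M z + ∑ p ∈ Λ, k p ^ 2 * discKernel R p z := by
  rw [regularDensity, sub_add_cancel]

lemma integrableOn_sq_norm_chargeField (hg : Integrable (regularDensity R Λ k M))
    (hS : ∀ p ∈ Λ, IntegrableOn (discKernel R p) S) :
    IntegrableOn (fun z => ‖chargeField Λ k M z‖ ^ 2) S := by
  simp only [sq_norm_chargeField_eq R]
  exact hg.integrableOn.add (integrable_finsetSum _ fun p hp => (hS p hp).const_mul _)

lemma setIntegral_sq_norm_chargeField (hg : Integrable (regularDensity R Λ k M))
    (hS : ∀ p ∈ Λ, IntegrableOn (discKernel R p) S) :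
    ∫ z in S, ‖chargeField Λ k M z‖ ^ 2 =
      (∫ z in S, regularDensity R Λ k M z) + ∑ p ∈ Λ, k p ^ 2 * ∫ z in S, discKernel R p z := by
  have hdisc : ∀ p ∈ Λ, IntegrableOn (fun z => k p ^ 2 * discKernel R p z) S :=
    fun p hp => (hS p hp).const_mul _
  simp only [sq_norm_chargeField_eq R]
  rw [integral_add hg.integrableOn (integrable_finsetSum _ hdisc), integral_finsetSum _ hdisc]
  simp only [integral_const_mul]

end

lemma tendsto_setIntegral_of_eventually_mem {g : ℂ → ℝ} (hg : Integrable g) {S : ℝ → Set ℂ}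
    (hS : ∀ η, MeasurableSet (S η)) (h : ∀ᵐ z : ℂ, ∀ᶠ η in 𝓝[>] (0 : ℝ), z ∈ S η) :
    Tendsto (fun η => ∫ z in S η, g z) (𝓝[>] 0) (𝓝 (∫ z, g z)) := by
  simp only [← fun η => integral_indicator (μ := volume) (f := g) (hS η)]
  refine tendsto_integral_filter_of_dominated_convergence (fun z => ‖g z‖)
    (Eventually.of_forall fun η => hg.aestronglyMeasurable.indicator (hS η))
    (Eventually.of_forall fun η => ae_of_all _ fun z => norm_indicator_le_norm_self _ _) hg.norm ?_
  filter_upwards [h] with z hz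
  refine tendsto_const_nhds.congr' ?_
  filter_upwards [hz] with η hη
  rw [Set.indicator_of_mem hη]

lemma eventually_mem_outerDomain (Λ : Finset ℝ) {z : ℂ} (hz : z.im ≠ 0) :
    ∀ᶠ η in 𝓝[>] (0 : ℝ), z ∈ outerDomain Λ η := by
  filter_upwards [Ioo_mem_nhdsGT (abs_pos.2 hz)] with η hη
  exact mem_outerDomain.2 fun p _ => hη.2.le.trans (abs_im_le_norm_sub_ofReal z p)

lemma eventually_mem_strip {z : ℂ} (hz : z.im ≠ 0) :
    ∀ᶠ δ in 𝓝[>] (0 : ℝ), z ∈ strip δ δ⁻¹ := by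
  filter_upwards [Ioo_mem_nhdsGT (abs_pos.2 hz), Ioo_mem_nhdsGT (inv_pos.2 (abs_pos.2 hz))]
    with δ hδ hδ_inv
  exact ⟨hδ.2, (lt_inv_comm₀ (abs_pos.2 hz) hδ.1).2 hδ_inv.2⟩

lemma tendsto_setIntegral_outerDomain {Λ : Finset ℝ} {k : ℝ → ℝ} {M : Measure ℝ} {R : ℝ}
    (hg : Integrable (regularDensity R Λ k M)) (hR : 0 < R)
    (hsep : ∀ p ∈ Λ, ∀ q ∈ Λ, p ≠ q → 2 * R ≤ |p - q|) :
    Tendsto (fun η => 1 / 2 * (∫ z in outerDomain Λ η, ‖chargeField Λ k M z‖ ^ 2) +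
        Real.pi * (∑ p ∈ Λ, k p ^ 2) * Real.log η) (𝓝[>] 0)
      (𝓝 (1 / 2 * (∫ z, regularDensity R Λ k M z) +
        Real.pi * (∑ p ∈ Λ, k p ^ 2) * Real.log R)) := by
  have hlim := tendsto_setIntegral_of_eventually_mem hg (measurableSet_outerDomain Λ)
    (ae_im_ne_zero.mono fun z hz => eventually_mem_outerDomain Λ hz)
  refine ((hlim.const_mul (1 / 2)).add_const
    (Real.pi * (∑ p ∈ Λ, k p ^ 2) * Real.log R)).congr' ?_
  filter_upwards [Ioo_mem_nhdsGT hR] with η hη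
  have hdisc : ∑ p ∈ Λ, k p ^ 2 * ∫ z in outerDomain Λ η, discKernel R p z =
      (∑ p ∈ Λ, k p ^ 2) * (2 * Real.pi * Real.log (R / η)) := by
    rw [Finset.sum_mul]
    refine Finset.sum_congr rfl fun p hp => ?_
    rw [setIntegral_outerDomain_discKernel hp (hsep p hp) hη.1 hη.2.le]
  rw [setIntegral_sq_norm_chargeField hg
    fun p hp => integrableOn_outerDomain_discKernel R hp hη.1, hdisc,
    Real.log_div hR.ne' hη.1.ne']
  ring

lemma chargeField_one (Λ : Finset ℝ) (M : Measure ℝ) (z : ℂ) :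
    chargeField Λ (fun _ => 1) M z =
      cauchyTransform (pointMeasure Λ) z - cauchyTransform M z := by
  rw [chargeField, show cauchyTransform (pointMeasure Λ) z = _ from integral_pointMeasure Λ _]
  simp only [one_smul]

lemma integral_regularDensity_one {M : Measure ℝ} [IsFiniteMeasure M] {C : NNReal}
    (hM : M ≤ C • volume) {L : ℝ} (hML : ∀ᵐ t ∂M, |t| ≤ L) {Λ : Finset ℝ}
    (hΛ : ∀ p ∈ Λ, |p| ≤ L) (hneutral : M.real Set.univ = Λ.card) {R : ℝ} (hR : 0 < R) :
    1 / 2 * (∫ z, regularDensity R Λ (fun _ => 1) M z) + Real.pi * Λ.card * Real.log R =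
      Real.pi * (-∑ p ∈ Λ, ∑ q ∈ Λ.erase p, Real.log |p - q| -
        2 * ∑ p ∈ Λ, logPotential M p + mutualEnergy M M) := by
  have hg : Integrable (regularDensity R Λ (fun _ => 1) M) :=
    integrable_regularDensity hML (fun _ => zero_le_one) hΛ (by simpa using hneutral) hM hR
  have hregular := tendsto_setIntegral_of_eventually_mem hg (fun δ => measurableSet_strip δ δ⁻¹)
    (ae_im_ne_zero.mono fun z hz => eventually_mem_strip hz)
  have hdisc : Tendsto (fun δ : ℝ => ∑ p ∈ Λ, ((∫ z in strip δ δ⁻¹, discKernel R p z) +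
      2 * Real.pi * Real.log δ)) (𝓝[>] 0)
      (𝓝 (∑ _p ∈ Λ, 2 * Real.pi * (Real.log R - Real.log 2))) :=
    tendsto_finsetSum _ fun p _ => tendsto_setIntegral_strip_discKernel hR p
  have hsum := (hregular.add hdisc).congr' (f₂ := fun δ : ℝ => (∫ z in strip δ δ⁻¹,
      ‖cauchyTransform (pointMeasure Λ) z - cauchyTransform M z‖ ^ 2) +
        2 * Real.pi * Λ.card * Real.log δ) (by
    filter_upwards [self_mem_nhdsWithin] with δ hδ
    simp only [← chargeField_one]
    rw [setIntegral_sq_norm_chargeField hg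
      fun p _ => integrableOn_strip_discKernel R p hδ δ⁻¹, Finset.sum_add_distrib]
    simp only [one_pow, one_mul, Finset.sum_const, nsmul_eq_mul]
    ring)
  have heq := tendsto_nhds_unique hsum (tendsto_integral_strip hΛ hM hML hneutral)
  rw [Finset.sum_const, nsmul_eq_mul] at heq
  linear_combination (1 / 2) * heq

/-! ### Blow-up of the background charge -/

/-- The image of `μ` under `x ↦ n x`, with its mass multiplied by `n`: the background charge of the
blown-up system. -/
noncomputable def blowUp (n : ℕ) (μ : Measure ℝ) : Measure ℝ :=
  (n : ENNReal) • μ.map fun s => (n : ℝ) * s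

instance isFiniteMeasure_blowUp (n : ℕ) (μ : Measure ℝ) [IsFiniteMeasure μ] :
    IsFiniteMeasure (blowUp n μ) :=
  Measure.smul_finite _ (ENNReal.natCast_ne_top n)

lemma blowUp_volume {n : ℕ} (hn : n ≠ 0) : blowUp n volume = volume := by
  have h := Real.smul_map_volume_mul_left (Nat.cast_ne_zero.2 hn : (n : ℝ) ≠ 0)
  rwa [Nat.abs_cast, ENNReal.ofReal_natCast] at h

lemma blowUp_withDensity {n : ℕ} (hn : n ≠ 0) (f : ℝ → ENNReal) :
    blowUp n (volume.withDensity f) = volume.withDensity fun t => f (t / n) := by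
  have hn' : (n : ℝ) ≠ 0 := Nat.cast_ne_zero.2 hn
  have hemb : MeasurableEmbedding fun s : ℝ => (n : ℝ) * s := measurableEmbedding_mulLeft₀ hn'
  conv_rhs => rw [← blowUp_volume hn]
  ext s hs
  rw [blowUp, blowUp, Measure.smul_apply, hemb.map_apply, withDensity_apply _ hs,
    withDensity_apply _ (hemb.measurable hs), Measure.restrict_smul, lintegral_smul_measure,
    hemb.restrict_map, hemb.lintegral_map]
  simp only [mul_div_cancel_left₀ _ hn']

lemma blowUp_le_smul_volume {n : ℕ} (hn : n ≠ 0) {μ : Measure ℝ} {C : NNReal}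
    (hμ : μ ≤ C • volume) : blowUp n μ ≤ C • volume :=
  calc blowUp n μ ≤ blowUp n (C • volume) :=
        Measure.le_iff'.2 fun s => mul_le_mul_right
          (Measure.map_mono hμ (by fun_prop : Measurable fun s : ℝ => (n : ℝ) * s) s) _
    _ = C • blowUp n volume := by rw [blowUp, blowUp, Measure.map_smul, smul_comm]
    _ = C • volume := by rw [blowUp_volume hn]

lemma integral_blowUp (n : ℕ) (μ : Measure ℝ) {f : ℝ → ℝ} (hf : Measurable f) :
    ∫ t, f t ∂blowUp n μ = n * ∫ s, f (n * s) ∂μ := by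
  rw [blowUp, integral_smul_measure, integral_map (by fun_prop) hf.aestronglyMeasurable]
  simp

lemma blowUp_real_univ (n : ℕ) (μ : Measure ℝ) [IsProbabilityMeasure μ] :
    (blowUp n μ).real Set.univ = n := by
  simpa using integral_blowUp n μ (f := fun _ => 1) measurable_const

lemma ae_blowUp_abs_le (n : ℕ) {μ : Measure ℝ} {L : ℝ} (hL : ∀ᵐ t ∂μ, |t| ≤ L) :
    ∀ᵐ t ∂blowUp n μ, |t| ≤ n * L := by
  refine Measure.ae_smul_measure ?_ _
  rw [ae_map_iff (by fun_prop) (measurableSet_le (by fun_prop) measurable_const)]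
  filter_upwards [hL] with t ht
  rw [abs_mul, Nat.abs_cast]
  gcongr

lemma log_abs_natCast_mul_sub {n : ℕ} (hn : n ≠ 0) {x y : ℝ} (h : x ≠ y) :
    Real.log |n * x - n * y| = Real.log n + Real.log |x - y| := by
  rw [← mul_sub, abs_mul, Nat.abs_cast,
    Real.log_mul (Nat.cast_ne_zero.2 hn) (abs_pos.2 (sub_ne_zero.2 h)).ne']

section

variable {n : ℕ} (hn : n ≠ 0) {μ : Measure ℝ} [IsProbabilityMeasure μ] {C : NNReal}
  (hμ : μ ≤ C • volume) {L : ℝ} (hL : ∀ᵐ t ∂μ, |t| ≤ L)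
include hn hμ hL

lemma logPotential_blowUp (x : ℝ) :
    logPotential (blowUp n μ) (n * x) = n * (logPotential μ x - Real.log n) := by
  have hmeas : Measurable fun t : ℝ => Real.log |n * x - t| :=
    Real.measurable_log.comp (by fun_prop)
  have hlog : ∫ s, Real.log |n * x - n * s| ∂μ = ∫ s, (Real.log n + Real.log |x - s|) ∂μ :=
    integral_congr_ae ((ae_ne_of_le_smul_volume hμ x).mono fun s => log_abs_natCast_mul_sub hn)
  rw [logPotential, integral_blowUp n μ hmeas, hlog,
    integral_add (integrable_const _) (integrable_log_abs_sub hμ hL x), integral_const,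
    probReal_univ, one_smul, logPotential]
  ring

lemma mutualEnergy_blowUp :
    mutualEnergy (blowUp n μ) (blowUp n μ) = n ^ 2 * (mutualEnergy μ μ - Real.log n) := by
  have hL' := ae_blowUp_abs_le n hL
  have hμ' := blowUp_le_smul_volume hn hμ
  have henergy := hasMutualEnergy_of_le_smul_volume hμ hL hL
  rw [mutualEnergy_eq_integral_logPotential (hasMutualEnergy_of_le_smul_volume hμ' hL' hL'),
    integral_blowUp n μ (continuous_logPotential hμ' hL').measurable]
  simp only [logPotential_blowUp hn hμ hL]
  rw [integral_const_mul, integral_sub henergy.integrable_logPotential (integrable_const _),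
    ← mutualEnergy_eq_integral_logPotential henergy, integral_const, probReal_univ, one_smul]
  ring

end

/-! ### The gradient of the blown-up potential -/

/-- The real-linear form `v ↦ Re (c v)`: the differential of a real potential with complex
derivative `c`. -/
noncomputable def reMul : ℂ →L[ℝ] ℂ →L[ℝ] ℝ :=
  (ContinuousLinearMap.compL ℝ ℂ ℂ ℝ Complex.reCLM).comp (ContinuousLinearMap.mul ℝ ℂ)

lemma reMul_apply (c v : ℂ) : reMul c v = (c * v).re := rfl

lemma norm_reMul (c : ℂ) : ‖reMul c‖ = ‖c‖ := by
  have hinner : reMul c = innerSL ℝ (starRingEnd ℂ c) := by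
    ext v
    simp [reMul_apply, Complex.inner, mul_comm]
  rw [hinner, innerSL_apply_norm, RCLike.norm_conj]

lemma hasFDerivAt_log_norm_sub {w t : ℂ} (h : w ≠ t) :
    HasFDerivAt (fun w : ℂ => Real.log ‖w - t‖) (reMul (w - t)⁻¹) w := by
  have hpos : 0 < ‖w - t‖ := norm_pos_iff.2 (sub_ne_zero.2 h)
  have hsq : (fun w : ℂ => Real.log ‖w - t‖) = fun w => 1 / 2 * Real.log (‖w - t‖ ^ 2) := by
    ext w
    rw [Real.log_pow, Nat.cast_ofNat]
    ring
  rw [hsq]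
  refine ((((hasFDerivAt_id w).sub_const t).norm_sq.log (pow_pos hpos 2).ne').const_mul
    (1 / 2)).congr_fderiv ?_
  ext v
  simp only [one_div, id_eq, map_sub, ContinuousLinearMap.comp_id, smul_apply, sub_apply,
    coe_innerSL_apply, Complex.inner, Complex.mul_re, Complex.conj_re, Complex.conj_im, mul_neg,
    sub_neg_eq_add, nsmul_eq_mul, Nat.cast_ofNat, smul_eq_mul, reMul_apply, Complex.inv_re,
    Complex.sub_re, Complex.normSq_eq_norm_sq, Complex.inv_im, Complex.sub_im, neg_sub]
  field_simp
  ring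

lemma measurable_log_norm_sub (w : ℂ) : Measurable fun t : ℝ => Real.log ‖w - (t : ℂ)‖ :=
  Real.measurable_log.comp (by fun_prop)

lemma ne_ofReal_of_im_ne_zero {w : ℂ} (hw : w.im ≠ 0) (t : ℝ) : w ≠ t := by
  rintro rfl
  exact hw (Complex.ofReal_im t)

section

variable {M : Measure ℝ} [IsFiniteMeasure M] {L : ℝ} (hL : ∀ᵐ t ∂M, |t| ≤ L) {w : ℂ}
  (hw : w.im ≠ 0)
include hL hw

lemma integrable_log_norm_sub : Integrable (fun t : ℝ => Real.log ‖w - (t : ℂ)‖) M := by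
  refine Integrable.of_bound (measurable_log_norm_sub w).aestronglyMeasurable
    (max |Real.log (‖w‖ + L)| |Real.log ‖w.im‖|) ?_
  filter_upwards [hL] with t ht
  have hlower : ‖w.im‖ ≤ ‖w - t‖ := abs_im_le_norm_sub_ofReal w t
  have hupper : ‖w - t‖ ≤ ‖w‖ + L := by
    refine (norm_sub_le _ _).trans ?_
    rw [Complex.norm_real]
    exact add_le_add_right ht _
  have hpos : 0 < ‖w.im‖ := norm_pos_iff.2 hw
  rw [Real.norm_eq_abs, max_comm]
  exact abs_le_max_abs_abs (Real.log_le_log hpos hlower)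
    (Real.log_le_log (hpos.trans_le hlower) hupper)

lemma hasFDerivAt_integral_log_norm_sub :
    HasFDerivAt (fun w : ℂ => ∫ t : ℝ, Real.log ‖w - (t : ℂ)‖ ∂M)
      (reMul (cauchyTransform M w)) w := by
  have hpos : 0 < |w.im| / 2 := half_pos (abs_pos.2 hw)
  have him : ∀ w' ∈ Metric.ball w (|w.im| / 2), |w.im| / 2 ≤ |w'.im| := fun w' hw' => by
    have hdist := (Complex.abs_im_le_norm (w - w')).trans_lt (mem_ball_iff_norm'.1 hw')
    rw [Complex.sub_im] at hdist
    linarith [abs_sub_abs_le_abs_sub w.im w'.im]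
  rw [cauchyTransform, ← reMul.integral_comp_comm (integrable_inv_sub_ofReal M hw)]
  exact hasFDerivAt_integral_of_dominated_of_fderiv_le (𝕜 := ℝ) (bound := fun _ => (|w.im| / 2)⁻¹)
    (Metric.ball_mem_nhds w hpos)
    (Eventually.of_forall fun w' => (measurable_log_norm_sub w').aestronglyMeasurable)
    (integrable_log_norm_sub hL hw)
    (reMul.continuous.comp_aestronglyMeasurable
      (integrable_inv_sub_ofReal M hw).aestronglyMeasurable)
    (ae_of_all _ fun t w' hw' => by
      rw [norm_reMul, norm_inv]
      exact inv_anti₀ hpos ((him w' hw').trans (abs_im_le_norm_sub_ofReal w' t)))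
    (integrable_const _)
    (ae_of_all _ fun t w' hw' => hasFDerivAt_log_norm_sub
      (ne_ofReal_of_im_ne_zero (abs_pos.1 (hpos.trans_le (him w' hw'))) t))

end

/-- The identification of `ℂ` with the plane. -/
noncomputable def planeEquiv : ℂ ≃ₗᵢ[ℝ] Plane := Complex.orthonormalBasisOneI.repr

lemma planeEquiv_ofReal (t : ℝ) : planeEquiv t = onLine t := by
  ext i
  fin_cases i <;> simp [planeEquiv, onLine, Complex.orthonormalBasisOneI_repr_apply]

lemma norm_planeEquiv_sub_onLine (w : ℂ) (t : ℝ) : ‖planeEquiv w - onLine t‖ = ‖w - t‖ := by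
  rw [← planeEquiv_ofReal, ← map_sub, LinearIsometryEquiv.norm_map]

lemma measurable_onLine : Measurable onLine := by
  rw [show onLine = fun t : ℝ => planeEquiv t from funext fun t => (planeEquiv_ofReal t).symm]
  exact planeEquiv.continuous.measurable.comp Complex.measurable_ofReal

lemma planeEquiv_preimage_compl_biUnion_ball (Λ : Finset ℝ) (η : ℝ) :
    planeEquiv ⁻¹' (⋃ p ∈ Λ, Metric.ball (onLine p) η)ᶜ = outerDomain Λ η := by
  ext z
  rw [mem_outerDomain]
  simp [dist_eq_norm, norm_planeEquiv_sub_onLine]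

/-- The number of charges `y i` located at `p`. -/
noncomputable def multiplicity {ι : Type*} [Fintype ι] (y : ι → ℝ) (p : ℝ) : ℝ :=
  (Finset.univ.filter fun i => y i = p).card

lemma sum_eq_sum_multiplicity {ι E : Type*} [Fintype ι] [AddCommGroup E] [Module ℝ E] (y : ι → ℝ)
    (f : ℝ → E) : ∑ i, f (y i) = ∑ p ∈ Finset.univ.image y, multiplicity y p • f p := by
  rw [Finset.sum_comp]
  simp only [multiplicity, Nat.cast_smul_eq_nsmul]

lemma sum_multiplicity {ι : Type*} [Fintype ι] (y : ι → ℝ) :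
    ∑ p ∈ Finset.univ.image y, multiplicity y p = Fintype.card ι := by
  simpa using (sum_eq_sum_multiplicity y fun _ => (1 : ℝ)).symm

lemma hasFDerivAt_neg_sum_log_sub_integral_log {ι : Type*} [Fintype ι] (y : ι → ℝ) {M : Measure ℝ}
    [IsFiniteMeasure M] {L : ℝ} (hL : ∀ᵐ t ∂M, |t| ≤ L) {w : ℂ} (hw : w.im ≠ 0) :
    HasFDerivAt
      (fun w : ℂ => -(∑ i, Real.log ‖w - (y i : ℂ)‖ - ∫ t : ℝ, Real.log ‖w - (t : ℂ)‖ ∂M))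
      (-reMul (chargeField (Finset.univ.image y) (multiplicity y) M w)) w := by
  rw [chargeField, ← sum_eq_sum_multiplicity y fun p => (w - (p : ℂ))⁻¹, map_sub, map_sum]
  exact ((HasFDerivAt.fun_sum fun i _ => hasFDerivAt_log_norm_sub
    (ne_ofReal_of_im_ne_zero hw (y i))).sub (hasFDerivAt_integral_log_norm_sub hL hw)).neg

lemma norm_gradient_planeEquiv (f : Plane → ℝ) (w : ℂ) :
    ‖gradient f (planeEquiv w)‖ = ‖fderiv ℝ (fun w => f (planeEquiv w)) w‖ := by
  have hcomp : fderiv ℝ (fun w => f (planeEquiv w)) w = (fderiv ℝ f (planeEquiv w)).comp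
      (planeEquiv.toContinuousLinearEquiv : ℂ →L[ℝ] Plane) :=
    planeEquiv.toContinuousLinearEquiv.comp_right_fderiv
  rw [gradient, LinearIsometryEquiv.norm_map, hcomp]
  exact (ContinuousLinearMap.opNorm_comp_linearIsometryEquiv _ planeEquiv).symm

lemma truncatedEnergy_one {E : Plane → Plane} {F : ℂ → ℂ}
    (hEF : ∀ᵐ z, ‖E (planeEquiv z)‖ = ‖F z‖) {Λ : Finset ℝ} {η : ℝ}
    (hF : IntegrableOn (fun z => ‖F z‖ ^ 2) (outerDomain Λ η)) :
    truncatedEnergy E Λ (fun _ => 1) η =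
      ((1 / 2 * (∫ z in outerDomain Λ η, ‖F z‖ ^ 2) + Real.pi * Λ.card * Real.log η : ℝ) :
        EReal) := by
  have hemb : MeasurableEmbedding planeEquiv := planeEquiv.toHomeomorph.measurableEmbedding
  have hae : (fun z => ‖F z‖ ^ 2) =ᵐ[volume.restrict (outerDomain Λ η)]
      fun z => (1 : ℝ) * ‖E (planeEquiv z)‖ ^ 2 :=
    ae_restrict_of_ae (hEF.mono fun z hz => by simp only [one_mul, hz])
  have hE : IntegrableOn (fun z => (1 : ℝ) * ‖E z‖ ^ 2)
      (⋃ p ∈ Λ, Metric.ball (onLine p) η)ᶜ := by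
    rw [← planeEquiv.measurePreserving.integrableOn_comp_preimage hemb,
      planeEquiv_preimage_compl_biUnion_ball]
    exact hF.congr hae
  rw [truncatedEnergy, eintegral_eq_coe hE (ae_eq_refl _),
    ← planeEquiv.measurePreserving.setIntegral_preimage_emb hemb,
    planeEquiv_preimage_compl_biUnion_ball, ← integral_congr_ae hae, ← EReal.coe_mul,
    ← EReal.coe_add, Finset.sum_const, nsmul_eq_mul, mul_one, mul_right_comm]

section BlownUp

variable {m₀ : ℝ → ℝ} {μ₀ : Measure ℝ}
  (hm₀ : μ₀ = volume.withDensity fun x => ENNReal.ofReal (m₀ x)) {n : ℕ} (hn : n ≠ 0)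
  (x : Fin n → ℝ)
include hm₀ hn

lemma lineMeasure_eq_map_blowUp :
    lineMeasure (fun t => m₀ (t / n)) = (blowUp n μ₀).map onLine := by
  rw [lineMeasure, hm₀, blowUp_withDensity hn]

lemma blownUpPotential_planeEquiv (w : ℂ) :
    blownUpPotential m₀ n x (planeEquiv w) =
      -(∑ i, Real.log ‖w - ((n * x i : ℝ) : ℂ)‖ -
        ∫ t : ℝ, Real.log ‖w - (t : ℂ)‖ ∂blowUp n μ₀) := by
  have hcharges : ∫ y, Real.log ‖planeEquiv w - y‖ ∂(∑ i, Measure.dirac (onLine (n * x i))) =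
      ∑ i, Real.log ‖w - ((n * x i : ℝ) : ℂ)‖ := by
    rw [integral_finsetSum_measure fun i _ => integrable_dirac (by simp)]
    simp only [integral_dirac, norm_planeEquiv_sub_onLine]
  have hbackground : ∫ y, Real.log ‖planeEquiv w - y‖ ∂(lineMeasure fun t => m₀ (t / n)) =
      ∫ t : ℝ, Real.log ‖w - (t : ℂ)‖ ∂blowUp n μ₀ := by
    have hmeas : Measurable fun y : Plane => Real.log ‖planeEquiv w - y‖ :=
      Real.measurable_log.comp (by fun_prop)
    rw [lineMeasure_eq_map_blowUp hm₀ hn,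
      integral_map measurable_onLine.aemeasurable hmeas.aestronglyMeasurable]
    simp only [norm_planeEquiv_sub_onLine]
  rw [blownUpPotential, invLaplacian, invLaplacian, hcharges, hbackground]
  field_simp

lemma ae_norm_gradient_blownUpPotential [IsFiniteMeasure μ₀] {L : ℝ} (hL : ∀ᵐ t ∂μ₀, |t| ≤ L) :
    ∀ᵐ w, ‖gradient (blownUpPotential m₀ n x) (planeEquiv w)‖ =
      ‖chargeField (Finset.univ.image fun i => (n : ℝ) * x i)
        (multiplicity fun i => (n : ℝ) * x i) (blowUp n μ₀) w‖ := by
  filter_upwards [ae_im_ne_zero] with w hw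
  rw [norm_gradient_planeEquiv, funext (blownUpPotential_planeEquiv hm₀ hn x),
    (hasFDerivAt_neg_sum_log_sub_integral_log (fun i => (n : ℝ) * x i)
      (ae_blowUp_abs_le n hL) hw).fderiv, norm_neg, norm_reMul]

end BlownUp

/-! ### The Hamiltonian -/

lemma eReal_sum_ne_bot {ι : Type*} (s : Finset ι) {f : ι → EReal} (h : ∀ i ∈ s, f i ≠ ⊥) :
    ∑ i ∈ s, f i ≠ ⊥ :=
  Finset.sum_induction f (· ≠ ⊥) (fun _ _ ha hb => by simp [EReal.add_eq_bot_iff, ha, hb])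
    EReal.zero_ne_bot h

lemma eReal_sum_eq_top {ι : Type*} {s : Finset ι} {f : ι → EReal} (h : ∀ i ∈ s, f i ≠ ⊥) {i : ι}
    (hi : i ∈ s) (hf : f i = ⊤) : ∑ i ∈ s, f i = ⊤ := by
  classical
  rw [← Finset.add_sum_erase _ _ hi, hf]
  exact EReal.top_add_of_ne_bot (eReal_sum_ne_bot _ fun j hj => h j (Finset.mem_of_mem_erase hj))

lemma eReal_coe_sum {ι : Type*} (s : Finset ι) (f : ι → ℝ) :
    ((∑ i ∈ s, f i : ℝ) : EReal) = ∑ i ∈ s, (f i : EReal) :=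
  map_sum (⟨⟨fun x : ℝ => (x : EReal), EReal.coe_zero⟩, EReal.coe_add⟩ : ℝ →+ EReal) f s

lemma hamiltonian_eq_top (V : ℝ → ℝ) {n : ℕ} {x : Fin n → ℝ} (hx : ¬ Function.Injective x) :
    hamiltonian V n x = ⊤ := by
  obtain ⟨i, j, hij, hne⟩ := Function.not_injective_iff.1 hx
  have hne_bot : ∀ i : Fin n, ∀ j ∈ Finset.univ.erase i, logKernel (x i) (x j) ≠ ⊥ :=
    fun i j _ => logKernel_ne_bot _ _
  have hinner : ∑ j ∈ Finset.univ.erase i, logKernel (x i) (x j) = ⊤ :=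
    eReal_sum_eq_top (hne_bot i) (Finset.mem_erase.2 ⟨hne.symm, Finset.mem_univ j⟩)
      (by rw [hij, logKernel_self])
  rw [hamiltonian, eReal_sum_eq_top (fun i _ => eReal_sum_ne_bot _ (hne_bot i))
    (Finset.mem_univ i) hinner]
  exact EReal.top_add_coe _

lemma hamiltonian_eq_coe (V : ℝ → ℝ) {n : ℕ} {x : Fin n → ℝ} (hx : Function.Injective x) :
    hamiltonian V n x =
      ((-∑ i, ∑ j ∈ Finset.univ.erase i, Real.log |x i - x j| + n * ∑ i, V (x i) : ℝ) :
        EReal) := by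
  have hkernel : ∀ i, ∑ j ∈ Finset.univ.erase i, logKernel (x i) (x j) =
      ((∑ j ∈ Finset.univ.erase i, -Real.log |x i - x j| : ℝ) : EReal) := fun i => by
    rw [eReal_coe_sum]
    exact Finset.sum_congr rfl fun j hj =>
      logKernel_of_ne (hx.ne (Finset.ne_of_mem_erase hj).symm)
  rw [hamiltonian, Finset.sum_congr rfl fun i _ => hkernel i, ← eReal_coe_sum, ← EReal.coe_add]
  simp only [Finset.sum_neg_distrib]

/-! ### The renormalized energy -/

lemma exists_common_bound {M : Measure ℝ} {L : ℝ} (hL : ∀ᵐ t ∂M, |t| ≤ L) (Λ : Finset ℝ) :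
    ∃ L', (∀ᵐ t ∂M, |t| ≤ L') ∧ ∀ p ∈ Λ, |p| ≤ L' := by
  obtain ⟨B, hB⟩ := (Λ.image abs).exists_le
  exact ⟨max L B, hL.mono fun t ht => ht.trans (le_max_left _ _),
    fun p hp => (hB _ (Finset.mem_image_of_mem _ hp)).trans (le_max_right _ _)⟩

lemma chargeField_congr {Λ : Finset ℝ} {k k' : ℝ → ℝ} (h : ∀ p ∈ Λ, k p = k' p) (M : Measure ℝ) :
    chargeField Λ k M = chargeField Λ k' M := by
  ext z
  rw [chargeField, chargeField, Finset.sum_congr rfl fun p hp => by rw [h p hp]]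

section Multiplicity

variable {ι : Type*} [Fintype ι] {y : ι → ℝ}

lemma multiplicity_of_injective (hy : Function.Injective y) {p : ℝ}
    (hp : p ∈ Finset.univ.image y) : multiplicity y p = 1 := by
  obtain ⟨i, -, rfl⟩ := Finset.mem_image.1 hp
  have hfiber : (Finset.univ.filter fun j => y j = y i) = {i} := by
    ext j
    simp [hy.eq_iff]
  simp [multiplicity, hfiber]

lemma one_le_multiplicity {p : ℝ} (hp : p ∈ Finset.univ.image y) : 1 ≤ multiplicity y p := by
  obtain ⟨i, -, rfl⟩ := Finset.mem_image.1 hp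
  rw [multiplicity, Nat.one_le_cast, Finset.one_le_card]
  exact ⟨i, by simp⟩

lemma card_lt_sum_sq_multiplicity (hy : ¬ Function.Injective y) :
    ((Finset.univ.image y).card : ℝ) < ∑ p ∈ Finset.univ.image y, multiplicity y p ^ 2 := by
  have hcard : (Finset.univ.image y).card < Fintype.card ι :=
    lt_of_le_of_ne Finset.card_image_le fun h => hy <| by
      simpa using Finset.card_image_iff.1 h
  calc ((Finset.univ.image y).card : ℝ) < Fintype.card ι := Nat.cast_lt.2 hcard
    _ = ∑ p ∈ Finset.univ.image y, multiplicity y p := (sum_multiplicity y).symm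
    _ ≤ ∑ p ∈ Finset.univ.image y, multiplicity y p ^ 2 :=
      Finset.sum_le_sum fun p hp => le_self_pow₀ (one_le_multiplicity hp) two_ne_zero

lemma integrable_regularDensity_multiplicity {M : Measure ℝ} [IsFiniteMeasure M] {C : NNReal}
    (hM : M ≤ C • volume) {L : ℝ} (hL : ∀ᵐ t ∂M, |t| ≤ L)
    (hneutral : M.real Set.univ = Fintype.card ι) {R : ℝ} (hR : 0 < R) :
    Integrable (regularDensity R (Finset.univ.image y) (multiplicity y) M) := by
  obtain ⟨L', hL', hΛ⟩ := exists_common_bound hL (Finset.univ.image y)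
  exact integrable_regularDensity hL' (fun _ => Nat.cast_nonneg _) hΛ
    (hneutral.trans (sum_multiplicity y).symm) hM hR

end Multiplicity

section BlowUpEnergy

variable {n : ℕ} (hn : n ≠ 0) {x : Fin n → ℝ}
include hn

lemma injective_natCast_mul_iff :
    (Function.Injective fun i => (n : ℝ) * x i) ↔ Function.Injective x :=
  (mul_right_injective₀ (Nat.cast_ne_zero.2 hn : (n : ℝ) ≠ 0)).of_comp_iff x

variable (hx : Function.Injective x)
include hx

lemma sum_log_blowUp :
    ∑ p ∈ Finset.univ.image (fun i => (n : ℝ) * x i),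
      ∑ q ∈ (Finset.univ.image fun i => (n : ℝ) * x i).erase p, Real.log |p - q| =
    n * (n - 1) * Real.log n + ∑ i, ∑ j ∈ Finset.univ.erase i, Real.log |x i - x j| := by
  have hy := (injective_natCast_mul_iff hn).2 hx
  have hrow : ∀ i : Fin n, ∑ j ∈ Finset.univ.erase i, Real.log |n * x i - n * x j| =
      (n - 1) * Real.log n + ∑ j ∈ Finset.univ.erase i, Real.log |x i - x j| := fun i => by
    rw [Finset.sum_congr rfl fun j hj => log_abs_natCast_mul_sub hn
        (hx.ne (Finset.ne_of_mem_erase hj).symm), Finset.sum_add_distrib, Finset.sum_const,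
      Finset.card_erase_of_mem (Finset.mem_univ i), Finset.card_univ, Fintype.card_fin,
      nsmul_eq_mul, Nat.cast_pred (Nat.pos_of_ne_zero hn)]
  rw [Finset.sum_image hy.injOn]
  simp only [← Finset.image_erase hy, Finset.sum_image hy.injOn]
  rw [Finset.sum_congr rfl fun i _ => hrow i, Finset.sum_add_distrib, Finset.sum_const,
    Finset.card_univ, Fintype.card_fin, nsmul_eq_mul, mul_assoc]

lemma interactionEnergy_blowUp {μ : Measure ℝ} [IsProbabilityMeasure μ] {C : NNReal}
    (hμ : μ ≤ C • volume) {L : ℝ} (hL : ∀ᵐ t ∂μ, |t| ≤ L) :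
    -∑ p ∈ Finset.univ.image (fun i => (n : ℝ) * x i),
        ∑ q ∈ (Finset.univ.image fun i => (n : ℝ) * x i).erase p, Real.log |p - q| -
      2 * ∑ p ∈ Finset.univ.image (fun i => (n : ℝ) * x i), logPotential (blowUp n μ) p +
      mutualEnergy (blowUp n μ) (blowUp n μ) =
    -∑ i, ∑ j ∈ Finset.univ.erase i, Real.log |x i - x j| - 2 * n * ∑ i, logPotential μ (x i) +
      n ^ 2 * mutualEnergy μ μ + n * Real.log n := by
  rw [sum_log_blowUp hn hx, mutualEnergy_blowUp hn hμ hL,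
    Finset.sum_image ((injective_natCast_mul_iff hn).2 hx).injOn]
  simp only [logPotential_blowUp hn hμ hL, ← Finset.mul_sum, Finset.sum_sub_distrib,
    Finset.sum_const, Finset.card_univ, Fintype.card_fin, nsmul_eq_mul]
  ring

end BlowUpEnergy

section RenormalizedEnergy

variable {m₀ : ℝ → ℝ} {μ₀ : Measure ℝ} [IsProbabilityMeasure μ₀]
  (hm₀ : μ₀ = volume.withDensity fun x => ENNReal.ofReal (m₀ x)) {C : NNReal}
  (hC : μ₀ ≤ C • volume) {L : ℝ} (hL : ∀ᵐ t ∂μ₀, |t| ≤ L) {n : ℕ} (hn : n ≠ 0)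
include hm₀ hC hL hn

lemma truncatedEnergy_blownUpPotential (x : Fin n → ℝ) {η : ℝ} (hη : 0 < η) :
    truncatedEnergy (gradient (blownUpPotential m₀ n x))
        (Finset.univ.image fun i => (n : ℝ) * x i) (fun _ => 1) η =
      ((1 / 2 * (∫ z in outerDomain (Finset.univ.image fun i => (n : ℝ) * x i) η,
          ‖chargeField (Finset.univ.image fun i => (n : ℝ) * x i)
            (multiplicity fun i => (n : ℝ) * x i) (blowUp n μ₀) z‖ ^ 2) +
        Real.pi * (Finset.univ.image fun i => (n : ℝ) * x i).card * Real.log η : ℝ) : EReal) := by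
  refine truncatedEnergy_one (ae_norm_gradient_blownUpPotential hm₀ hn x hL)
    (integrableOn_sq_norm_chargeField (R := 1) ?_ fun p hp =>
      integrableOn_outerDomain_discKernel 1 hp hη)
  exact integrable_regularDensity_multiplicity (blowUp_le_smul_volume hn hC)
    (ae_blowUp_abs_le n hL) (by rw [blowUp_real_univ, Fintype.card_fin]) one_pos

/-- The truncated energy diverges like `π (#Λ - ∑ k²) log η`, where the multiplicities `k` satisfy
`#Λ < ∑ k²`. -/
lemma hasRenormalizedEnergy_of_not_injective {x : Fin n → ℝ} (hx : ¬ Function.Injective x) :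
    HasRenormalizedEnergy (gradient (blownUpPotential m₀ n x))
      (Finset.univ.image fun i => (n : ℝ) * x i) (fun _ => 1) ⊤ := by
  obtain ⟨R, hsep, hR⟩ := ((eventually_two_mul_le_abs_sub
    (Finset.univ.image fun i => (n : ℝ) * x i)).and self_mem_nhdsWithin).exists
  have hlim := tendsto_setIntegral_outerDomain (integrable_regularDensity_multiplicity
    (y := fun i => (n : ℝ) * x i) (blowUp_le_smul_volume hn hC) (ae_blowUp_abs_le n hL)
    (by rw [blowUp_real_univ, Fintype.card_fin]) hR) hR hsep
  have hexcess := sub_neg.2 (card_lt_sum_sq_multiplicity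
    (mt (injective_natCast_mul_iff hn).1 hx))
  have htop := Real.tendsto_log_nhdsGT_zero.const_mul_atBot_of_neg
    (mul_neg_of_pos_of_neg Real.pi_pos hexcess)
  refine (EReal.tendsto_coe_nhds_top_iff.2 (hlim.add_atTop htop)).congr' ?_
  filter_upwards [self_mem_nhdsWithin] with η hη
  rw [truncatedEnergy_blownUpPotential hm₀ hC hL hn x hη]
  congr 1
  ring

lemma hasRenormalizedEnergy_of_injective {x : Fin n → ℝ} (hx : Function.Injective x) :
    HasRenormalizedEnergy (gradient (blownUpPotential m₀ n x))
      (Finset.univ.image fun i => (n : ℝ) * x i) (fun _ => 1)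
      ((Real.pi * (-∑ i, ∑ j ∈ Finset.univ.erase i, Real.log |x i - x j| -
        2 * n * ∑ i, logPotential μ₀ (x i) + n ^ 2 * mutualEnergy μ₀ μ₀ + n * Real.log n) : ℝ) :
        EReal) := by
  have hy := (injective_natCast_mul_iff hn).2 hx
  set Λ : Finset ℝ := Finset.univ.image fun i => (n : ℝ) * x i
  have hcard : (Λ.card : ℝ) = n := by
    rw [Finset.card_image_of_injective _ hy, Finset.card_univ, Fintype.card_fin]
  have hM := blowUp_le_smul_volume hn hC
  have hneutral := (blowUp_real_univ n μ₀).trans hcard.symm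
  obtain ⟨L', hL', hΛ⟩ := exists_common_bound (ae_blowUp_abs_le n hL) Λ
  obtain ⟨R, hsep, hR⟩ :=
    ((eventually_two_mul_le_abs_sub Λ).and self_mem_nhdsWithin).exists
  have hlim := tendsto_setIntegral_outerDomain (integrable_regularDensity (k := fun _ => 1) hL'
    (fun _ => zero_le_one) hΛ (by simpa using hneutral) hM hR) hR hsep
  simp only [one_pow, Finset.sum_const, nsmul_eq_mul, mul_one] at hlim
  rw [integral_regularDensity_one hM hL' hΛ hneutral hR, interactionEnergy_blowUp hn hx hC hL,
    ← chargeField_congr fun p hp => multiplicity_of_injective hy hp] at hlim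
  refine (EReal.tendsto_coe.2 hlim).congr' ?_
  filter_upwards [self_mem_nhdsWithin] with η hη
  rw [truncatedEnergy_blownUpPotential hm₀ hC hL hn x hη]

end RenormalizedEnergy

/-! ### The splitting formula -/

section Splitting

variable {V : ℝ → ℝ} {μ : Measure ℝ} {n : ℕ} {x : Fin n → ℝ} {F : ℝ}

lemma hamiltonian_splitting_of_injective
    (hF : meanFieldEnergy V μ = ((mutualEnergy μ μ + ∫ t, V t ∂μ : ℝ) : EReal))
    (hx : Function.Injective x) :
    hamiltonian V n x = (((n : ℝ) ^ 2 : ℝ) : EReal) * meanFieldEnergy V μ -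
      ((n * Real.log n : ℝ) : EReal) + ((1 / Real.pi : ℝ) : EReal) *
        ((Real.pi * (-∑ i, ∑ j ∈ Finset.univ.erase i, Real.log |x i - x j| -
          2 * n * ∑ i, logPotential μ (x i) + n ^ 2 * mutualEnergy μ μ + n * Real.log n) : ℝ) :
          EReal) +
      ((2 * n * ∑ i, zeta V μ (robinConstant V μ) (x i) : ℝ) : EReal) := by
  rw [hamiltonian_eq_coe V hx, hF, ← EReal.coe_mul, ← EReal.coe_mul, ← EReal.coe_sub,
    ← EReal.coe_add, ← EReal.coe_add, EReal.coe_eq_coe_iff]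
  simp only [zeta, robinConstant, Finset.sum_sub_distrib, Finset.sum_add_distrib,
    ← Finset.sum_div, Finset.sum_const, Finset.card_univ, Fintype.card_fin, nsmul_eq_mul]
  field_simp
  ring

lemma hamiltonian_splitting_of_not_injective (hF : meanFieldEnergy V μ = (F : EReal))
    (hx : ¬ Function.Injective x) (c : ℝ) :
    hamiltonian V n x = (((n : ℝ) ^ 2 : ℝ) : EReal) * meanFieldEnergy V μ -
      ((n * Real.log n : ℝ) : EReal) + ((1 / Real.pi : ℝ) : EReal) * ⊤ +
      ((2 * n * ∑ i, zeta V μ c (x i) : ℝ) : EReal) := by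
  rw [hamiltonian_eq_top V hx, hF, EReal.coe_mul_top_of_pos (by positivity),
    ← EReal.coe_mul, ← EReal.coe_sub, EReal.coe_add_top, EReal.top_add_coe]

end Splitting

end LogGas

theorem mainTheorem6_general (V m₀ : ℝ → ℝ) (μ₀ : Measure ℝ) (hV_lsc : LowerSemicontinuous V)
    (hμ₀ : LogGas.IsEquilibriumMeasure V μ₀)
    (hm₀ : μ₀ = volume.withDensity (fun x => ENNReal.ofReal (m₀ x)))
    (hsupp : IsCompact μ₀.support) (hm₀_bounds : ∃ mbar : ℝ, ∀ x, m₀ x ∈ Set.Icc 0 mbar) :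
    (∃! c : ℝ, LogGas.IsEquilibriumConstant V μ₀ c) ∧
    ∀ c : ℝ, LogGas.IsEquilibriumConstant V μ₀ c →
      ∀ (n : ℕ), 1 ≤ n → ∀ x : Fin n → ℝ,
        ∃ W : EReal,
          LogGas.HasRenormalizedEnergy (gradient (LogGas.blownUpPotential m₀ n x))
            (Finset.univ.image (fun i => (n : ℝ) * x i)) (fun _ => 1) W ∧
          LogGas.hamiltonian V n x =
            (((n : ℝ) ^ 2 : ℝ) : EReal) * LogGas.meanFieldEnergy V μ₀
              - ((n * Real.log n : ℝ) : EReal)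
              + ((1 / Real.pi : ℝ) : EReal) * W
              + ((2 * n * ∑ i, LogGas.zeta V μ₀ c (x i) : ℝ) : EReal) := by
  have hprob := hμ₀.1
  obtain ⟨mbar, hbounds⟩ := hm₀_bounds
  obtain ⟨L, hL⟩ := LogGas.exists_ae_abs_le_of_isCompact hsupp Measure.support_mem_ae
  have hC : μ₀ ≤ mbar.toNNReal • volume :=
    hm₀ ▸ LogGas.withDensity_ofReal_le_smul_volume fun x => (hbounds x).2
  have hF := LogGas.meanFieldEnergy_eq_coe (LogGas.hasMutualEnergy_of_le_smul_volume hC hL hL)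
    (hμ₀.integrable_potential hV_lsc hL)
  have huniq : ∀ c, LogGas.IsEquilibriumConstant V μ₀ c → c = LogGas.robinConstant V μ₀ :=
    fun c => LogGas.IsEquilibriumConstant.eq_robinConstant hV_lsc hμ₀ hC hL
  refine ⟨⟨_, LogGas.isEquilibriumConstant_robinConstant hV_lsc hμ₀ hC hL, huniq⟩, ?_⟩
  intro c hc n hn x
  have hn0 : n ≠ 0 := Nat.one_le_iff_ne_zero.1 hn
  by_cases hx : Function.Injective x
  · rw [huniq c hc]
    exact ⟨_, LogGas.hasRenormalizedEnergy_of_injective hm₀ hC hL hn0 hx,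
      LogGas.hamiltonian_splitting_of_injective hF hx⟩
  · exact ⟨⊤, LogGas.hasRenormalizedEnergy_of_not_injective hm₀ hC hL hn0 hx,
      LogGas.hamiltonian_splitting_of_not_injective hF hx c⟩

theorem mainTheorem6 (V m₀ : ℝ → ℝ) (μ₀ : Measure ℝ)
    (hV_lsc : LowerSemicontinuous V)
    (hV_growth : Tendsto (fun x : ℝ => V x / 2 - Real.log |x|) (cocompact ℝ) atTop)
    (hμ₀ : LogGas.IsEquilibriumMeasure V μ₀)
    (hm₀ : μ₀ = volume.withDensity (fun x => ENNReal.ofReal (m₀ x)))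
    (hsupp : ∃ (M : ℕ) (a b : Fin M → ℝ), (∀ k, a k ≤ b k) ∧
      μ₀.support = ⋃ k, Set.Icc (a k) (b k))
    (hm₀_bounds : ∃ γ mbar : ℝ, 0 < γ ∧ 0 < mbar ∧ ∀ x : ℝ,
      γ * Real.sqrt (Metric.infDist x (μ₀.support)ᶜ) ≤ m₀ x ∧ m₀ x ≤ mbar)
    (hm₀_holder : ∃ C : NNReal, HolderWith C (1 / 2) m₀)
    (hV_int : ∃ β₁ : ℝ, 0 < β₁ ∧
      IntegrableOn (fun x : ℝ => Real.exp (-β₁ * (V x / 2 - Real.log |x|)))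
        (Set.Icc (-1) 1)ᶜ) :
    (∃! c : ℝ, LogGas.IsEquilibriumConstant V μ₀ c) ∧
    ∀ c : ℝ, LogGas.IsEquilibriumConstant V μ₀ c →
      ∀ (n : ℕ), 1 ≤ n → ∀ x : Fin n → ℝ,
        ∃ W : EReal,
          LogGas.HasRenormalizedEnergy (gradient (LogGas.blownUpPotential m₀ n x))
            (Finset.univ.image (fun i => (n : ℝ) * x i)) (fun _ => 1) W ∧
          LogGas.hamiltonian V n x =
            (((n : ℝ) ^ 2 : ℝ) : EReal) * LogGas.meanFieldEnergy V μ₀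
              - ((n * Real.log n : ℝ) : EReal)
              + ((1 / Real.pi : ℝ) : EReal) * W
              + ((2 * n * ∑ i, LogGas.zeta V μ₀ c (x i) : ℝ) : EReal) := by
  obtain ⟨γ, mbar, hγ, -, hbounds⟩ := hm₀_bounds
  obtain ⟨M, a, b, -, hM⟩ := hsupp
  have hcompact : IsCompact μ₀.support := hM ▸ isCompact_iUnion fun k => isCompact_Icc
  exact mainTheorem6_general V m₀ μ₀ hV_lsc hμ₀ hm₀ hcompact ⟨mbar, fun x =>
    ⟨(mul_nonneg hγ.le (Real.sqrt_nonneg _)).trans (hbounds x).1, (hbounds x).2⟩⟩
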